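/- **Setting.** Let $\mathcal Y$ (with a $\sigma$-finite reference measure $dy$, e.g. Lebesgue or counting measure) and $\mathcal X$ be measurable spaces, and let $f(y|x,\theta)>0$, $y\in\mathcal Y$, $x\in\mathcal X$, $\theta\in\mathbb R^p$, be jointly measurable in $(y,x)$ for each $\theta$. Put $$C(x,\theta)=\int f(y|x,\theta)\,dy,\qquad p(y|x,\theta)=\frac{f(y|x,\theta)}{C(x,\theta)} .$$ Let $(Y_1,X_1),(Y_2,X_2),\dots$ be i.i.d. pairs with an arbitrary joint law $g$ on $\mathcal Y\times\mathcal X$ (the model may be misspecified), and let $Y^1,Y^2,\dots$ be i.i.d. with probability density $h$, $h>0$ almost everywhere, independent of the pairs. Put $$C_m(x,\theta)=\frac1m\sum_{k=1}^m\frac{f(Y^k|x,\theta)}{h(Y^k)},\qquad \ell_n^m(\theta)=\sum_{i=1}^n\log f(Y_i|X_i,\theta)-\sum_{i=1}^n\log C_m(X_i,\theta),$$ $$\bar\ell_n(\theta)=\frac1n\sum_{i=1}^n\bigl[\log f(Y_i|X_i,\theta)-\log C(X_i,\theta)\bigr].$$ Let $\theta_\star$ maximize $\theta\mapsto E_{(Y,X)\sim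 g}\log p(Y|X,\theta)$ (among the $\theta$ for which this expectation is finite), and let $\hat\theta_n^m$ be random vectors such that, with probability tending to $1$ as $n,m\to\infty$, $\hat\theta_n^m$ maximizes $\ell_n^m$ over $\mathbb R^p$. For some $\delta>0$ let $U=\{\theta:|\theta-\theta_\star|\le\delta\}$, and let $E_g\log p(Y|X,\theta)$ be finite for $\theta\in U$. The symbols $\nabla,\nabla^2$ denote derivatives in $\theta$, $|\cdot|$ is the Euclidean (for matrices: Frobenius) norm, and $$\phi(y|x)=\frac1{C(x,\theta_\star)}\left[\frac{\nabla f(y|x,\theta_\star)}{h(y)}-\frac{\nabla C(x,\theta_\star)}{C(x,\theta_\star)}\,\frac{f(y|x,\theta_\star)}{h(y)}\right].$$ **Theorem.** Suppose that 1. for all $y,x$ the second partial derivatives of $f(y|x,\theta)$ in $\theta$ exist and are continuous, and for each fixed $x$ the first and second derivatives may be passed under the integral sign in $\int f(y|x,\theta)\,dy$; 2. $\sqrt{\min(n,m)}\,(\hat\theta_n^m-\theta_\star)=O_p(1)$ as $n,m\to\infty$; 3. the matrices $V=\mathrm{VAR}_{(Y,X)\sim g}\nabla\log p(Y|X,\theta_\star)$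 and $D(\theta)=E_{(Y,X)\sim g}\nabla^2\log p(Y|X,\theta)$, $\theta\in U$, exist, the expectation $E_{Y\sim h,\,X\sim g}|\phi(Y|X)|^2$ is finite ($Y$ and $X$ being independent here), and $D=D(\theta_\star)$ is negative definite; 4. $D(\theta)$ is continuous at $\theta_\star$; 5. $\sup_{\theta\in U}|\nabla^2\bar\ell_n(\theta)-D(\theta)|\to_p0$ as $n\to\infty$; 6. as $m\to\infty$: (a) $\sup_{x\in\mathcal X}|C_m(x,\theta_\star)-C(x,\theta_\star)|\to_p0$; (b) $\sup_{x\in\mathcal X}|\nabla C_m(x,\theta_\star)-\nabla C(x,\theta_\star)|\to_p0$; (c) $\sup_{\theta\in U,\,x\in\mathcal X}|\nabla^2C_m(x,\theta)-\nabla^2C(x,\theta)|\to_p0$; 7. there are constants $\alpha>0$, $K>0$ such that for all $x\in\mathcal X$ and $\theta\in U$: $\alpha\le C(x,\theta)\le K$, $|\nabla C(x,\theta)|\le K$ and $|\nabla^2C(x,\theta)|\le K$. Then $\bar\phi(y)=E_{X\sim g}\phi(y|X)$ exists for $h$-almost every $y$, the matrix $W=\mathrm{VAR}_{Y\sim h}\,E_{X\sim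 g}\,\phi(Y|X)$ is finite, and, if $V$ and $W$ are nonsingular (i.e. positive definite), $$\left(\frac Vn+\frac Wm\right)^{-1/2}D\,\bigl(\hat\theta_n^m-\theta_\star\bigr)\to_d\mathcal N(0,I)$$ as $n,m\to\infty$ jointly, at arbitrary relative rates. -/

import Mathlib

open MeasureTheory ProbabilityTheory Filter Topology
open scoped ENNReal Gradient MatrixOrder

noncomputable section

namespace MCML

/-- The parameter space `ℝ^p` with its Euclidean norm. -/
abbrev Par (p : ℕ) : Type := EuclideanSpace ℝ (Fin p)

/-- The Hessian matrix of a function on `ℝ^p`, the Jacobian of its gradient: the entry `(r, s)` is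
the derivative in direction `e_s` of the `r`-th component of the gradient. -/
def hess {p : ℕ} (F : Par p → ℝ) (t : Par p) : Matrix (Fin p) (Fin p) ℝ :=
  Matrix.of fun r s => (fderiv ℝ (∇ F) t (EuclideanSpace.single s 1)) r

/-- The Euclidean (Frobenius) norm of a matrix. -/
def frob {p : ℕ} (A : Matrix (Fin p) (Fin p) ℝ) : ℝ :=
  Real.sqrt (∑ r, ∑ s, A r s ^ 2)

/-- `A ^ (-1/2)` for a positive definite matrix `A`: the positive square root of `A⁻¹`. -/
def invSqrt {p : ℕ} (A : Matrix (Fin p) (Fin p) ℝ) : Matrix (Fin p) (Fin p) ℝ :=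
  CFC.sqrt A⁻¹

/-- The variance-covariance matrix of a random vector `Z` under `μ`. -/
def covMat {S : Type*} [MeasurableSpace S] {p : ℕ} (μ : Measure S) (Z : S → Par p) :
    Matrix (Fin p) (Fin p) ℝ :=
  Matrix.of fun r s => covariance (fun a => Z a r) (fun a => Z a s) μ

/-- The entrywise expectation of a random matrix `A` under `μ`. -/
def expMat {S : Type*} [MeasurableSpace S] {p : ℕ} (μ : Measure S)
    (A : S → Matrix (Fin p) (Fin p) ℝ) : Matrix (Fin p) (Fin p) ℝ :=
  Matrix.of fun r s => ∫ a, A a r s ∂μ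

/-- Convergence to `0` in probability along the filter `l`, for nonnegative quantities such as
suprema, which need not be measurable (`P` is then read as the outer measure). -/
def TendstoZeroInProb {Ω ι : Type*} [MeasurableSpace Ω] (P : Measure Ω) (l : Filter ι)
    (Z : ι → Ω → ℝ≥0∞) : Prop :=
  ∀ ε : ℝ≥0∞, 0 < ε → Tendsto (fun i => P {ω | ε ≤ Z i ω}) l (𝓝 0)

/-- `Z = O_p(1)` along the filter `l`. -/
def BoundedInProb {Ω ι : Type*} [MeasurableSpace Ω] (P : Measure Ω) (l : Filter ι)
    (Z : ι → Ω → ℝ) : Prop :=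
  ∀ ε : ℝ≥0∞, 0 < ε → ∃ M : ℝ, ∀ᶠ i in l, P {ω | M < |Z i ω|} ≤ ε

section Model

variable {𝒴 𝒳 : Type*} [MeasurableSpace 𝒴] [MeasurableSpace 𝒳] {p : ℕ}

/-- The norming constant `C(x, θ) = ∫ f(y | x, θ) dy`. -/
def normConst (ν : Measure 𝒴) (f : 𝒴 → 𝒳 → Par p → ℝ) (x : 𝒳) (θ : Par p) : ℝ :=
  ∫ y, f y x θ ∂ν

/-- `log p(y | x, θ)` where `p(y | x, θ) = f(y | x, θ) / C(x, θ)`. -/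
def logDens (ν : Measure 𝒴) (f : 𝒴 → 𝒳 → Par p → ℝ) (y : 𝒴) (x : 𝒳) (θ : Par p) : ℝ :=
  Real.log (f y x θ / normConst ν f x θ)

/-- The importance sampling distribution with density `h`. -/
def instrLaw (ν : Measure 𝒴) (h : 𝒴 → ℝ) : Measure 𝒴 :=
  ν.withDensity fun y => ENNReal.ofReal (h y)

/-- The Monte Carlo approximation
`C_m(x, θ) = (1/m) ∑_{k ≤ m} f(Y^k | x, θ) / h(Y^k)` of the norming constant. -/
def mcConst (f : 𝒴 → 𝒳 → Par p → ℝ) (h : 𝒴 → ℝ) (ys : ℕ → 𝒴) (m : ℕ) (x : 𝒳)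
    (θ : Par p) : ℝ :=
  (m : ℝ)⁻¹ * ∑ k ∈ Finset.range m, f (ys k) x θ / h (ys k)

/-- The Monte Carlo log-likelihood
`ℓ_n^m(θ) = ∑_{i ≤ n} log f(Y_i | X_i, θ) - ∑_{i ≤ n} log C_m(X_i, θ)`. -/
def mcLogLik (f : 𝒴 → 𝒳 → Par p → ℝ) (h : 𝒴 → ℝ) (zs : ℕ → 𝒴 × 𝒳) (ys : ℕ → 𝒴) (n m : ℕ)
    (θ : Par p) : ℝ :=
  ∑ i ∈ Finset.range n, Real.log (f (zs i).1 (zs i).2 θ) -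
    ∑ i ∈ Finset.range n, Real.log (mcConst f h ys m (zs i).2 θ)

/-- The normalized exact log-likelihood
`(1/n) ∑_{i ≤ n} [log f(Y_i | X_i, θ) - log C(X_i, θ)]`. -/
def avgLogLik (ν : Measure 𝒴) (f : 𝒴 → 𝒳 → Par p → ℝ) (zs : ℕ → 𝒴 × 𝒳) (n : ℕ)
    (θ : Par p) : ℝ :=
  (n : ℝ)⁻¹ * ∑ i ∈ Finset.range n,
    (Real.log (f (zs i).1 (zs i).2 θ) - Real.log (normConst ν f (zs i).2 θ))

/-- First and second derivatives in `θ` may be passed under the integral sign in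
`∫ f(y | x, θ) dy`, for the fixed value `x`. -/
structure DiffUnderIntegral (ν : Measure 𝒴) (f : 𝒴 → 𝒳 → Par p → ℝ) (x : 𝒳) : Prop where
  integrable (θ : Par p) : Integrable (fun y => f y x θ) ν
  integrable_grad (θ : Par p) : Integrable (fun y => ∇ (f y x) θ) ν
  integrable_hess (θ : Par p) (r s : Fin p) : Integrable (fun y => hess (f y x) θ r s) ν
  hasGradientAt (θ : Par p) : HasGradientAt (normConst ν f x) (∫ y, ∇ (f y x) θ ∂ν) θ
  differentiableAt_grad (θ : Par p) : DifferentiableAt ℝ (∇ (normConst ν f x)) θ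
  hess_eq (θ : Par p) : hess (normConst ν f x) θ = expMat ν fun y => hess (f y x) θ

/-- The score `∇ log p(y | x, θ)` as a function of the pair `(y, x)`. -/
def score (ν : Measure 𝒴) (f : 𝒴 → 𝒳 → Par p → ℝ) (θ : Par p) (z : 𝒴 × 𝒳) : Par p :=
  ∇ (logDens ν f z.1 z.2) θ

/-- `V = VAR_{(Y, X) ∼ g} ∇ log p(Y | X, θ)`. -/
def matV (ν : Measure 𝒴) (f : 𝒴 → 𝒳 → Par p → ℝ) (G : Measure (𝒴 × 𝒳)) (θ : Par p) :
    Matrix (Fin p) (Fin p) ℝ :=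
  covMat G (score ν f θ)

/-- `D(θ) = E_{(Y, X) ∼ g} ∇² log p(Y | X, θ)`. -/
def matD (ν : Measure 𝒴) (f : 𝒴 → 𝒳 → Par p → ℝ) (G : Measure (𝒴 × 𝒳)) (θ : Par p) :
    Matrix (Fin p) (Fin p) ℝ :=
  expMat G fun z => hess (logDens ν f z.1 z.2) θ

/-- `φ(y | x) = [∇f(y|x,θ)/h(y) - (∇C(x,θ)/C(x,θ)) f(y|x,θ)/h(y)] / C(x,θ)`. -/
def phi (ν : Measure 𝒴) (f : 𝒴 → 𝒳 → Par p → ℝ) (h : 𝒴 → ℝ) (θ : Par p) (y : 𝒴) (x : 𝒳) :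
    Par p :=
  (normConst ν f x θ)⁻¹ •
    ((h y)⁻¹ • ∇ (f y x) θ -
      (f y x θ / h y) • (normConst ν f x θ)⁻¹ • ∇ (normConst ν f x) θ)

/-- `E_{X ∼ g} φ(y | X)`, the expectation being over the marginal law of the covariate. -/
def phiBar (ν : Measure 𝒴) (f : 𝒴 → 𝒳 → Par p → ℝ) (h : 𝒴 → ℝ) (G : Measure (𝒴 × 𝒳))
    (θ : Par p) (y : 𝒴) : Par p :=
  ∫ x, phi ν f h θ y x ∂G.snd

/-- `W = VAR_{Y ∼ h} E_{X ∼ g} φ(Y | X)`. -/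
def matW (ν : Measure 𝒴) (f : 𝒴 → 𝒳 → Par p → ℝ) (h : 𝒴 → ℝ) (G : Measure (𝒴 × 𝒳))
    (θ : Par p) : Matrix (Fin p) (Fin p) ℝ :=
  covMat (instrLaw ν h) (phiBar ν f h G θ)

end Model

end MCML

end

/-! Near `θs` the gradient of the normalized Monte Carlo log-likelihood is the exact score mean
minus the average over `i` of `∇ log C_m - ∇ log C` at `X_i`, and it vanishes at the estimator. Its
derivative is uniformly close to `D`: the Hessians of the exact log-likelihood converge by
hypothesis, and those of `log C_m - log C` are small uniformly in `x`, because `C` and its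
derivatives stay in one compact set bounded away from zero. The mean value inequality then gives `D
(θhat - θs) = R - S` up to `o(‖θhat - θs‖)`, where `S` is the score mean and `R` the Monte Carlo
error of the score (`norm_expansion_le`).

At `θs` the error `∇ log C_m - ∇ log C` is exactly `C / C_m` times the sample mean of `φ`
(`gradient_log_mcConst_sub`). The ratio is uniformly close to 1, so `R` may be replaced by a
two-sample mean of the kernel `φ`, which has mean zero in `y` for each `x`. Subtracting its
projection `phiBar` leaves a kernel centred in both variables, whose double sum has second moment of
order `n * m` rather than `n * m * (n + m)`; the remainder is therefore negligible at scale `√min(n,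
m)` (`withHighProb_double_mean`). Together these reductions give `withHighProb_asymptotic_linear`:
`D (θhat - θs)` is the mean of `phiBar` minus the score mean, up to `o_p(min(n, m)^(-1/2))`.

The two means are independent, and both are centred; for the score this is first-order optimality of
the Kullback-Leibler projection (`integral_score_eq_zero`). Their difference has covariance `V/n +
W/m`, and no limit of `n/m` is needed: standardizing keeps the arguments of both characteristic
functions on a fixed ellipsoid, where convergence to the Gaussian is uniform
(`tendstoInDistribution_two_sample`). Since `(V/n + W/m)^(-1/2)` has norm at most a constant times
`√min(n, m)` (`exists_norm_invSqrt_le`), the linearization error disappears by Slutsky's theorem. -/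

noncomputable section

namespace MCML

/-! ### Calculus of events of probability tending to one -/

section HighProbability

variable {Ω ι κ : Type*} [MeasurableSpace Ω] {P : Measure Ω} {l : Filter ι}

/-- The events `E i` have outer probability tending to one along `l`. -/
def WithHighProb (P : Measure Ω) (l : Filter ι) (E : ι → Ω → Prop) : Prop :=
  Tendsto (fun i => P {ω | ¬ E i ω}) l (𝓝 0)

theorem WithHighProb.mono {E F : ι → Ω → Prop} (h : WithHighProb P l E)
    (h' : ∀ᶠ i in l, ∀ ω, E i ω → F i ω) : WithHighProb P l F := by
  refine tendsto_of_tendsto_of_tendsto_of_le_of_le' tendsto_const_nhds h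
    (Eventually.of_forall fun _ => zero_le) ?_
  filter_upwards [h'] with i hi
  exact measure_mono fun ω hω hE => hω (hi ω hE)

theorem WithHighProb.and {E F : ι → Ω → Prop} (h : WithHighProb P l E)
    (h' : WithHighProb P l F) : WithHighProb P l (fun i ω => E i ω ∧ F i ω) := by
  have h2 := Tendsto.add h h'
  rw [add_zero] at h2
  refine tendsto_of_tendsto_of_tendsto_of_le_of_le tendsto_const_nhds h2
    (fun _ => zero_le) fun i => ?_
  refine (measure_mono fun ω hω => ?_).trans (measure_union_le _ _)
  by_cases hE : E i ω
  · exact Or.inr fun hF => hω ⟨hE, hF⟩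
  · exact Or.inl hE

theorem WithHighProb.comp {l' : Filter κ} {E : ι → Ω → Prop} (h : WithHighProb P l E)
    {u : κ → ι} (hu : Tendsto u l' l) : WithHighProb P l' (fun k => E (u k)) :=
  Tendsto.comp (f := u) (g := fun i => P {ω | ¬ E i ω}) h hu

/-- Turns probabilistic information into a deterministic conclusion: an event of positive
probability contains a sample point. -/
theorem WithHighProb.exists [l.NeBot] [IsProbabilityMeasure P] {E : ι → Ω → Prop}
    (h : WithHighProb P l E) {Q : ι → Prop} (hQ : ∀ᶠ i in l, Q i) :
    ∃ i ω, Q i ∧ E i ω := by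
  obtain ⟨i, hi, hQi⟩ := (((h.eventually (gt_mem_nhds one_pos))).and hQ).exists
  by_contra hne
  push Not at hne
  have : {ω | ¬ E i ω} = Set.univ := Set.eq_univ_of_forall fun ω => hne i ω hQi
  simp [this] at hi

theorem TendstoZeroInProb.withHighProb {Z : ι → Ω → ℝ≥0∞} (h : TendstoZeroInProb P l Z)
    {ε : ℝ≥0∞} (hε : 0 < ε) : WithHighProb P l (fun i ω => Z i ω < ε) := by
  simpa [WithHighProb] using h ε hε

theorem withHighProb_of_tendsto_ae {E : Type*} [NormedAddCommGroup E] [IsFiniteMeasure P]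
    {X : ℕ → Ω → E} {c : E} (hX : ∀ n, AEStronglyMeasurable (X n) P)
    (h : ∀ᵐ ω ∂P, Tendsto (fun n => X n ω) atTop (𝓝 c)) {ε : ℝ} (hε : 0 < ε) :
    WithHighProb P atTop (fun n ω => ‖X n ω - c‖ < ε) := by
  have := tendstoInMeasure_of_tendsto_ae (g := fun _ => c) hX h
  rw [tendstoInMeasure_iff_norm] at this
  simpa [WithHighProb] using this ε hε

/-- The rule `o_p(1) * O_p(1) = o_p(1)`, in the form by which all remainders below are disposed of.
-/
theorem BoundedInProb.withHighProb_lt {X Z : ι → Ω → ℝ} (hX : BoundedInProb P l X)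
    (h : ∀ η > 0, WithHighProb P l (fun i ω => Z i ω ≤ η * |X i ω|)) {ε : ℝ} (hε : 0 < ε) :
    WithHighProb P l (fun i ω => Z i ω < ε) := by
  refine ENNReal.tendsto_nhds_zero.2 fun r hr => ?_
  obtain ⟨M, hM⟩ := hX (r / 2) (ENNReal.half_pos hr.ne')
  have hM1 : 0 < |M| + 1 := by positivity
  filter_upwards [hM, ENNReal.tendsto_nhds_zero.1 (h (ε / (|M| + 1)) (by positivity)) (r / 2)
    (ENNReal.half_pos hr.ne')] with i h1 h2
  calc P {ω | ¬ Z i ω < ε}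
      ≤ P ({ω | M < |X i ω|} ∪ {ω | ¬ Z i ω ≤ ε / (|M| + 1) * |X i ω|}) := by
        refine measure_mono fun ω hω => ?_
        by_contra hc
        simp only [Set.mem_union, Set.mem_ofPred_eq, not_or, not_lt, not_not] at hc hω
        have : ε / (|M| + 1) * |X i ω| < ε := by
          rw [div_mul_eq_mul_div, div_lt_iff₀ hM1]
          have : |X i ω| < |M| + 1 := by linarith [hc.1, le_abs_self M]
          gcongr
        linarith [hc.2]
    _ ≤ r / 2 + r / 2 := (measure_union_le _ _).trans (add_le_add h1 h2)
    _ = r := ENNReal.add_halves r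

/-- Markov's inequality. -/
theorem BoundedInProb.of_lintegral_le {Z : ι → Ω → ℝ} (hZ : ∀ i, AEMeasurable (Z i) P)
    {C : ℝ≥0∞} (hC : C ≠ ∞) (h : ∀ i, ∫⁻ ω, ‖Z i ω‖ₑ ∂P ≤ C) : BoundedInProb P l Z := by
  intro ε hε
  by_cases hεt : ε = ∞
  · exact ⟨0, Eventually.of_forall fun i => hεt ▸ le_top⟩
  have hdt : C / ε ≠ ∞ := ENNReal.div_ne_top hC hε.ne'
  -- The summand 1 keeps the threshold nonzero when `C = 0`, so that it can be cancelled at the end.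
  refine ⟨(C / ε).toReal + 1, Eventually.of_forall fun i => ?_⟩
  have h0 : C / ε + 1 ≠ 0 := by simp
  have ht : C / ε + 1 ≠ ∞ := by simp [hdt]
  have hm := mul_meas_ge_le_lintegral₀ (hZ i).enorm (C / ε + 1)
  have hsub : {ω | (C / ε).toReal + 1 < |Z i ω|} ⊆ {ω | C / ε + 1 ≤ ‖Z i ω‖ₑ} := by
    intro ω hω
    simp only [Set.mem_ofPred_eq] at hω ⊢
    rw [← ofReal_norm, Real.norm_eq_abs, ← ENNReal.ofReal_toReal hdt, ← ENNReal.ofReal_one,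
      ← ENNReal.ofReal_add ENNReal.toReal_nonneg one_pos.le]
    exact ENNReal.ofReal_le_ofReal hω.le
  refine (measure_mono hsub).trans ?_
  refine (ENNReal.mul_le_mul_iff_right h0 ht).1 ((hm.trans (h i)).trans ?_)
  calc C = C / ε * ε := (ENNReal.div_mul_cancel hε.ne' hεt).symm
    _ ≤ (C / ε + 1) * ε := by gcongr; exact le_self_add

end HighProbability

/-! ### Gradients, Hessians and the second derivative of a logarithm -/

section Calculus

variable {p : ℕ}

/-- Cauchy-Schwarz in each row. This is the passage from the matrix hypotheses to operator norms, in
which the mean value inequality is stated. -/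
theorem norm_le_frob (T : Par p →L[ℝ] Par p) (A : Matrix (Fin p) (Fin p) ℝ)
    (h : ∀ r s, T (EuclideanSpace.single s 1) r = A r s) : ‖T‖ ≤ frob A := by
  refine T.opNorm_le_bound (Real.sqrt_nonneg _) fun v => ?_
  have hv : v = ∑ s, v s • EuclideanSpace.single s (1 : ℝ) := by
    ext i
    simp [Finset.sum_apply, Pi.single_apply]
  have hT : ∀ r, T v r = ∑ s, A r s * v s := by
    intro r
    conv_lhs => rw [hv]
    simp [map_sum, Finset.sum_apply, h, mul_comm]
  rw [EuclideanSpace.norm_eq, EuclideanSpace.norm_eq, frob, ← Real.sqrt_mul (by positivity)]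
  refine Real.sqrt_le_sqrt ?_
  rw [Finset.sum_mul]
  refine Finset.sum_le_sum fun r _ => ?_
  simp only [Real.norm_eq_abs, sq_abs, hT]
  exact Finset.sum_mul_sq_le_sq_mul_sq _ _ _

theorem norm_fderiv_gradient_le_frob (F : Par p → ℝ) (θ : Par p) :
    ‖fderiv ℝ (∇ F) θ‖ ≤ frob (hess F θ) :=
  norm_le_frob _ _ fun _ _ => rfl

theorem norm_fderiv_gradient_sub_le_frob (F G : Par p → ℝ) (θ : Par p) :
    ‖fderiv ℝ (∇ F) θ - fderiv ℝ (∇ G) θ‖ ≤ frob (hess F θ - hess G θ) :=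
  norm_le_frob _ _ fun _ _ => rfl

theorem norm_fderiv_gradient_sub_toEuclideanLin_le_frob (F : Par p → ℝ) (θ : Par p)
    (A : Matrix (Fin p) (Fin p) ℝ) :
    ‖fderiv ℝ (∇ F) θ - (Matrix.toEuclideanLin A).toContinuousLinearMap‖ ≤
      frob (hess F θ - A) :=
  norm_le_frob _ _ fun r s => by simp [hess, Matrix.toLpLin_apply]

theorem norm_toEuclideanLin_le_frob (A : Matrix (Fin p) (Fin p) ℝ) :
    ‖(Matrix.toEuclideanLin A).toContinuousLinearMap‖ ≤ frob A :=
  norm_le_frob _ _ fun r s => by simp [Matrix.toLpLin_apply]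

theorem continuous_frob : Continuous (frob (p := p)) := by
  unfold frob
  fun_prop

theorem differentiable_gradient {F : Par p → ℝ} (hF : ContDiff ℝ 2 F) :
    Differentiable ℝ (∇ F) := by
  have h1 : ContDiff ℝ 1 (fderiv ℝ F) := hF.fderiv_right (by norm_num)
  exact (InnerProductSpace.toDual ℝ (Par p)).symm.toContinuousLinearEquiv.differentiable.comp
    (h1.differentiable one_ne_zero)

theorem norm_gradient (F : Par p → ℝ) (θ : Par p) : ‖∇ F θ‖ = ‖fderiv ℝ F θ‖ :=
  (InnerProductSpace.toDual ℝ (Par p)).symm.norm_map _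

theorem inner_gradient (F : Par p → ℝ) (θ v : Par p) :
    inner ℝ (∇ F θ) v = fderiv ℝ F θ v := by
  simp [gradient]

theorem gradient_sub {F G : Par p → ℝ} {θ : Par p} (hF : DifferentiableAt ℝ F θ)
    (hG : DifferentiableAt ℝ G θ) : ∇ (fun t => F t - G t) θ = ∇ F θ - ∇ G θ := by
  simp [gradient, fderiv_fun_sub hF hG]

theorem gradient_const_mul (F : Par p → ℝ) (θ : Par p) (c : ℝ) :
    ∇ (fun t => c * F t) θ = c • ∇ F θ := by
  have : fderiv ℝ (fun t => c * F t) θ = c • fderiv ℝ F θ := by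
    exact congrFun (fderiv_const_smul_field (𝕜 := ℝ) (f := F) c) θ
  simp [gradient, this]

theorem gradient_sum {ι : Type*} (s : Finset ι) {F : ι → Par p → ℝ} {θ : Par p}
    (hF : ∀ i ∈ s, DifferentiableAt ℝ (F i) θ) :
    ∇ (fun t => ∑ i ∈ s, F i t) θ = ∑ i ∈ s, ∇ (F i) θ := by
  simp [gradient, fderiv_fun_sum hF]

theorem gradient_log {F : Par p → ℝ} {θ : Par p} (hF : DifferentiableAt ℝ F θ)
    (h0 : F θ ≠ 0) : ∇ (fun t => Real.log (F t)) θ = (F θ)⁻¹ • ∇ F θ := by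
  simp [gradient, fderiv.log hF h0]

/-- The second derivative of `log F` in terms of `F`, its gradient and its second derivative. -/
def logHess (q : ℝ × Par p × (Par p →L[ℝ] Par p)) : Par p →L[ℝ] Par p :=
  q.1⁻¹ • q.2.2 - (q.1 ^ 2)⁻¹ • (innerSL ℝ q.2.1).smulRight q.2.1

theorem continuousAt_logHess {q : ℝ × Par p × (Par p →L[ℝ] Par p)} (h : q.1 ≠ 0) :
    ContinuousAt logHess q := by
  have h1 : ContinuousAt (fun q : ℝ × Par p × (Par p →L[ℝ] Par p) => q.1⁻¹) q :=
    continuousAt_fst.inv₀ h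
  have h2 : ContinuousAt (fun q : ℝ × Par p × (Par p →L[ℝ] Par p) => (q.1 ^ 2)⁻¹) q :=
    (continuousAt_fst.pow 2).inv₀ (pow_ne_zero 2 h)
  have h3 : Continuous (fun q : ℝ × Par p × (Par p →L[ℝ] Par p) =>
      (innerSL ℝ q.2.1).smulRight q.2.1) := by
    have := (ContinuousLinearMap.smulRightL ℝ (Par p) (Par p)).continuous₂
    exact this.comp (((innerSL ℝ).continuous.comp (continuous_fst.comp continuous_snd)).prodMk
      (continuous_fst.comp continuous_snd))
  exact (h1.smul (continuous_snd.comp continuous_snd).continuousAt).sub (h2.smul h3.continuousAt)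

/-- Product rule for `F⁻¹ • ∇ F`. Only differentiability of `∇ F` at the point is asked, since
continuity of the second derivative is not available for the norming constant. -/
theorem hasFDerivAt_gradient_log {F : Par p → ℝ} (hF : Differentiable ℝ F)
    (h0 : ∀ t, F t ≠ 0) {θ : Par p} (hF' : DifferentiableAt ℝ (∇ F) θ) :
    HasFDerivAt (∇ fun t => Real.log (F t)) (logHess (F θ, ∇ F θ, fderiv ℝ (∇ F) θ)) θ := by
  have h1 : (∇ fun t => Real.log (F t)) = fun t => (F t)⁻¹ • ∇ F t :=
    funext fun t => gradient_log (hF t) (h0 t)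
  have h2 : HasFDerivAt (fun t => (F t)⁻¹) (-(F θ ^ 2)⁻¹ • fderiv ℝ F θ) θ := by
    exact (hasDerivAt_inv (h0 θ)).comp_hasFDerivAt θ (hF θ).hasFDerivAt
  rw [h1]
  convert! h2.smul hF'.hasFDerivAt using 1
  ext v : 1
  simp [logHess, sub_eq_add_neg, smul_smul]

/-- `logHess` is uniformly continuous near the compact region described by the bounds. -/
theorem exists_logHess_close {α K ε : ℝ} (hα : 0 < α) (hε : 0 < ε) :
    ∃ η > 0, ∀ (a b : ℝ) (u v : Par p) (A B : Par p →L[ℝ] Par p),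
      α ≤ b → b ≤ K → ‖v‖ ≤ K → ‖B‖ ≤ K → |a - b| < η → ‖u - v‖ < η → ‖A - B‖ < η →
      ‖logHess (a, u, A) - logHess (b, v, B)‖ < ε := by
  have hc : IsCompact (Set.Icc α K ×ˢ
      (Metric.closedBall (0 : Par p) K ×ˢ Metric.closedBall (0 : Par p →L[ℝ] Par p) K)) :=
    isCompact_Icc.prod ((isCompact_closedBall _ _).prod (isCompact_closedBall _ _))
  -- Only the base point `(b, v, B)` has to lie in the compact set; the perturbed point may leave
  -- it.
  have hu := hc.uniformContinuousAt_of_continuousAt logHess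
    (fun q hq => continuousAt_logHess (hα.trans_le hq.1.1).ne') (Metric.dist_mem_uniformity hε)
  obtain ⟨η, hη, h⟩ := Metric.mem_uniformity_dist.1 hu
  refine ⟨η, hη, fun a b u v A B h1 h2 h3 h4 h5 h6 h7 => ?_⟩
  have := h (a := (b, v, B)) (b := (a, u, A)) (by
    rw [dist_comm]
    simp [dist_eq_norm, h5, h6, h7]) ⟨⟨h1, h2⟩, by simpa using h3, by simpa using h4⟩
  rw [← dist_eq_norm, dist_comm]
  exact this

/-- Mean value inequality from the centre of the ball. It spreads closeness at `θ₀` alone over the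
whole ball once the derivatives are uniformly close. -/
theorem norm_le_of_norm_fderiv_le {E : Type*} [NormedAddCommGroup E] [NormedSpace ℝ E]
    {g : Par p → E} (hg : Differentiable ℝ g) {θ₀ : Par p} {δ c : ℝ} (hδ : 0 ≤ δ)
    (h : ∀ θ ∈ Metric.closedBall θ₀ δ, ‖fderiv ℝ g θ‖ ≤ c) :
    ∀ θ ∈ Metric.closedBall θ₀ δ, ‖g θ‖ ≤ ‖g θ₀‖ + c * δ := by
  intro θ hθ
  have h0 : θ₀ ∈ Metric.closedBall θ₀ δ := Metric.mem_closedBall_self hδ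
  have h1 := (convex_closedBall θ₀ δ).norm_image_sub_le_of_norm_fderiv_le
    (fun x _ => hg x) h h0 hθ
  have hc : 0 ≤ c := (norm_nonneg _).trans (h θ₀ h0)
  have h2 : c * ‖θ - θ₀‖ ≤ c * δ := by
    gcongr
    exact mem_closedBall_iff_norm.1 hθ
  have h3 := norm_sub_norm_le (g θ) (g θ₀)
  linarith

/-- Closeness of two positive functions in the `C²` sense, at `θ₀` for the function and its
gradient and uniformly on a ball for the second derivative, makes the second derivatives of their
logarithms uniformly close on the ball. -/
theorem exists_fderiv_gradient_log_close {α K ε δ : ℝ} (hα : 0 < α) (hε : 0 < ε)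
    (hδ : 0 ≤ δ) :
    ∃ η > 0, ∀ (θ₀ : Par p) (F G : Par p → ℝ), Differentiable ℝ F → Differentiable ℝ G →
      Differentiable ℝ (∇ F) → Differentiable ℝ (∇ G) → (∀ t, F t ≠ 0) → (∀ t, G t ≠ 0) →
      (∀ θ ∈ Metric.closedBall θ₀ δ, α ≤ G θ ∧ G θ ≤ K ∧ ‖∇ G θ‖ ≤ K ∧
        ‖fderiv ℝ (∇ G) θ‖ ≤ K) →
      |F θ₀ - G θ₀| ≤ η → ‖∇ F θ₀ - ∇ G θ₀‖ ≤ η →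
      (∀ θ ∈ Metric.closedBall θ₀ δ, ‖fderiv ℝ (∇ F) θ - fderiv ℝ (∇ G) θ‖ ≤ η) →
      ∀ θ ∈ Metric.closedBall θ₀ δ,
        ‖fderiv ℝ (∇ fun t => Real.log (F t)) θ - fderiv ℝ (∇ fun t => Real.log (G t)) θ‖
          ≤ ε := by
  obtain ⟨η, hη, h⟩ := exists_logHess_close (p := p) (K := K) hα hε
  -- With data closeness `κ`, the gradients differ by at most `κ * (1 + δ)` on the ball, hence the
  -- functions by at most `κ * (1 + (1 + δ) * δ)`. Both are below `κ * (M + 1) = η`.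
  set M : ℝ := 1 + (1 + δ) * δ + δ with hM
  have hM0 : 0 < M + 1 := by positivity
  refine ⟨η / (M + 1), by positivity, ?_⟩
  intro θ₀ F G dF dG dF' dG' F0 G0 hb h1 h2 h3 θ hθ
  set κ := η / (M + 1) with hκ
  have hκ0 : 0 < κ := by positivity
  have hκM : κ * (M + 1) = η := by rw [hκ]; field_simp
  have hgrad : ∀ t, fderiv ℝ (∇ F - ∇ G) t = fderiv ℝ (∇ F) t - fderiv ℝ (∇ G) t :=
    fun t => fderiv_sub (dF' t) (dG' t)
  have h4 : ∀ t ∈ Metric.closedBall θ₀ δ, ‖∇ F t - ∇ G t‖ ≤ κ * (1 + δ) := by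
    intro t ht
    have := norm_le_of_norm_fderiv_le (g := ∇ F - ∇ G) (dF'.sub dG') hδ
      (fun t ht => by rw [hgrad]; exact h3 t ht) t ht
    simp only [Pi.sub_apply] at this
    linarith
  have h5 : ∀ t ∈ Metric.closedBall θ₀ δ, |F t - G t| ≤ κ * (1 + (1 + δ) * δ) := by
    intro t ht
    have := norm_le_of_norm_fderiv_le (g := fun t => F t - G t) (dF.sub dG) hδ
      (fun t ht => by
        rw [← norm_gradient, gradient_sub (dF t) (dG t)]; exact h4 t ht) t ht
    simp only [Real.norm_eq_abs] at this
    nlinarith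
  rw [(hasFDerivAt_gradient_log dF F0 (dF' θ)).fderiv,
    (hasFDerivAt_gradient_log dG G0 (dG' θ)).fderiv]
  obtain ⟨b1, b2, b3, b4⟩ := hb θ hθ
  have hδδ : 0 ≤ κ * δ := by positivity
  have hδ2 : 0 ≤ κ * ((1 + δ) * δ) := by positivity
  refine (h _ _ _ _ _ _ b1 b2 b3 b4 ((h5 θ hθ).trans_lt ?_) ((h4 θ hθ).trans_lt ?_)
    ((h3 θ hθ).trans_lt ?_)).le
  all_goals nlinarith

end Calculus

/-! ### Second moments of one-sample and two-sample sums -/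

section SecondMoments

variable {Ω S T : Type*} [MeasurableSpace Ω] [MeasurableSpace S] [MeasurableSpace T] {p : ℕ}
  {P : Measure Ω} [IsProbabilityMeasure P]

theorem enorm_sq_eq_sum (v : Par p) : ‖v‖ₑ ^ 2 = ∑ r, ‖v r‖ₑ ^ 2 := by
  simp only [← ofReal_norm, ← ENNReal.ofReal_pow (norm_nonneg _)]
  rw [← ENNReal.ofReal_sum_of_nonneg fun _ _ => by positivity, EuclideanSpace.norm_sq_eq]

theorem lintegral_enorm_sq_eq_ofReal {μ : Measure S} {u : S → ℝ} (hu : MemLp u 2 μ) :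
    ∫⁻ y, ‖u y‖ₑ ^ 2 ∂μ = ENNReal.ofReal (∫ y, u y ^ 2 ∂μ) := by
  rw [ofReal_integral_eq_lintegral_ofReal hu.integrable_sq (ae_of_all _ fun _ => sq_nonneg _)]
  refine lintegral_congr fun y => ?_
  rw [← ofReal_norm, ← ENNReal.ofReal_pow (norm_nonneg _), Real.norm_eq_abs, sq_abs]

theorem lintegral_enorm_sq_ne_top {E : Type*} [NormedAddCommGroup E] {μ : Measure S} {u : S → E}
    (hu : MemLp u 2 μ) : ∫⁻ y, ‖u y‖ₑ ^ 2 ∂μ ≠ ∞ := by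
  have := hu.2
  rw [eLpNorm_lt_top_iff_lintegral_rpow_enorm_lt_top two_ne_zero ENNReal.ofNat_ne_top] at this
  simpa using this.ne

theorem memLp_two_of_lintegral_ne_top {E : Type*} [NormedAddCommGroup E] {μ : Measure S}
    {u : S → E} (hu : AEStronglyMeasurable u μ) (h : ∫⁻ y, ‖u y‖ₑ ^ 2 ∂μ ≠ ∞) :
    MemLp u 2 μ := by
  refine ⟨hu, ?_⟩
  rw [eLpNorm_lt_top_iff_lintegral_rpow_enorm_lt_top two_ne_zero ENNReal.ofNat_ne_top]
  simpa using h.lt_top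

/-- Second moment of a sum of i.i.d. centred real random variables. -/
theorem lintegral_sum_iid_sq_le_real {μ : Measure S} {Y : ℕ → Ω → S}
    (hY : ∀ k, Measurable (Y k)) (hlaw : ∀ k, P.map (Y k) = μ) (hind : iIndepFun Y P)
    {u : S → ℝ} (hu : Measurable u) (h0 : ∫ y, u y ∂μ = 0) (m : ℕ) :
    ∫⁻ ω, ‖∑ k ∈ Finset.range m, u (Y k ω)‖ₑ ^ 2 ∂P ≤ m * ∫⁻ y, ‖u y‖ₑ ^ 2 ∂μ := by
  -- An infinite second moment makes the bound trivial except for `m = 0`, where the right side is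
  -- `0 * ∞ = 0`.
  rcases Nat.eq_zero_or_pos m with rfl | hm
  · simp
  by_cases htop : ∫⁻ y, ‖u y‖ₑ ^ 2 ∂μ = ∞
  · simp [htop, hm.ne']
  have hL : MemLp u 2 μ := memLp_two_of_lintegral_ne_top hu.aestronglyMeasurable htop
  have hLk : ∀ k, MemLp (fun ω => u (Y k ω)) 2 P := fun k =>
    (memLp_map_measure_iff (f := Y k) (by rw [hlaw k]; exact hL.1) (hY k).aemeasurable).1
      (by rw [hlaw k]; exact hL)
  have hint : ∀ k, ∫ ω, u (Y k ω) ∂P = 0 := fun k => by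
    rw [← h0, ← hlaw k, integral_map (hY k).aemeasurable hu.aestronglyMeasurable]
  have hsq : ∀ k, ∫ ω, u (Y k ω) ^ 2 ∂P = ∫ y, u y ^ 2 ∂μ := fun k => by
    rw [← hlaw k, integral_map (hY k).aemeasurable (hu.pow_const 2).aestronglyMeasurable]
  have hLs : MemLp (fun ω => ∑ k ∈ Finset.range m, u (Y k ω)) 2 P :=
    memLp_finsetSum _ fun k _ => hLk k
  have hvar := IndepFun.variance_sum (μ := P) (X := fun k ω => u (Y k ω)) (s := Finset.range m)
    (fun k _ => hLk k) (fun i _ j _ hij => (hind.indepFun hij).comp hu hu)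
  have hs0 : ∫ ω, ∑ k ∈ Finset.range m, u (Y k ω) ∂P = 0 := by
    rw [integral_finsetSum _ fun k _ => (hLk k).integrable (by norm_num)]
    simp [hint]
  have hfun : (∑ k ∈ Finset.range m, fun ω => u (Y k ω)) =
      fun ω => ∑ k ∈ Finset.range m, u (Y k ω) := by
    ext ω; simp
  rw [hfun, variance_of_integral_eq_zero hLs.1.aemeasurable hs0] at hvar
  rw [lintegral_enorm_sq_eq_ofReal hLs, lintegral_enorm_sq_eq_ofReal hL, hvar]
  simp_rw [variance_of_integral_eq_zero (hLk _).1.aemeasurable (hint _), hsq]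
  simp [ENNReal.ofReal_mul]

/-- Second moment of a sum of i.i.d. centred random vectors. -/
theorem lintegral_sum_iid_sq_le {μ : Measure S} {Y : ℕ → Ω → S}
    (hY : ∀ k, Measurable (Y k)) (hlaw : ∀ k, P.map (Y k) = μ) (hind : iIndepFun Y P)
    {u : S → Par p} (hu : Measurable u) (hui : Integrable u μ) (h0 : ∫ y, u y ∂μ = 0) (m : ℕ) :
    ∫⁻ ω, ‖∑ k ∈ Finset.range m, u (Y k ω)‖ₑ ^ 2 ∂P ≤ m * ∫⁻ y, ‖u y‖ₑ ^ 2 ∂μ := by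
  have hr : ∀ r, Measurable fun y => u y r := fun r => by fun_prop
  have h0r : ∀ r, ∫ y, u y r ∂μ = 0 := fun r => by
    have := (EuclideanSpace.proj (𝕜 := ℝ) r).integral_comp_comm hui
    simpa [h0] using this
  simp_rw [enorm_sq_eq_sum]
  rw [lintegral_finsetSum _ fun r _ => by fun_prop, lintegral_finsetSum _ fun r _ => by fun_prop,
    Finset.mul_sum]
  refine Finset.sum_le_sum fun r _ => ?_
  simpa using lintegral_sum_iid_sq_le_real hY hlaw hind (hr r) (h0r r) m

/-- From `t ≤ 1 + t ^ 2`. The case `N = 0` is harmless because `(√0)⁻¹ = 0`. -/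
theorem lintegral_enorm_inv_sqrt_smul_le {v : Ω → Par p} (hv : Measurable v) {N : ℕ} {I : ℝ≥0∞}
    (h : ∫⁻ ω, ‖v ω‖ₑ ^ 2 ∂P ≤ N * I) : ∫⁻ ω, ‖(√(N : ℝ))⁻¹ • v ω‖ₑ ∂P ≤ 1 + I := by
  calc ∫⁻ ω, ‖(√(N : ℝ))⁻¹ • v ω‖ₑ ∂P
      ≤ ∫⁻ ω, 1 + ‖(√(N : ℝ))⁻¹ • v ω‖ₑ ^ 2 ∂P := by
        refine lintegral_mono fun ω => ?_
        rcases le_total ‖(√(N : ℝ))⁻¹ • v ω‖ₑ 1 with h | h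
        · exact h.trans le_self_add
        · exact (le_self_pow₀ h two_ne_zero).trans le_add_self
    _ ≤ 1 + I := by
        rw [lintegral_add_left measurable_const]
        simp only [lintegral_const, measure_univ, mul_one]
        refine add_le_add_right ?_ _
        simp only [enorm_smul, mul_pow]
        rw [lintegral_const_mul _ (hv.enorm.pow_const 2)]
        refine (mul_le_mul_right h _).trans ?_
        rw [← mul_assoc]
        refine mul_le_of_le_one_left' ?_
        rcases Nat.eq_zero_or_pos N with rfl | hn
        · simp
        · have hs : ‖(√(N : ℝ))⁻¹‖ₑ ^ 2 = ((N : ℝ≥0∞))⁻¹ := by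
            rw [← ofReal_norm, ← ENNReal.ofReal_pow (norm_nonneg _), norm_inv, Real.norm_eq_abs,
              inv_pow, sq_abs, Real.sq_sqrt (Nat.cast_nonneg N),
              ENNReal.ofReal_inv_of_pos (by exact_mod_cast hn), ENNReal.ofReal_natCast]
          rw [hs, ENNReal.inv_mul_cancel (by exact_mod_cast hn.ne') (ENNReal.natCast_ne_top N)]

/-- Fubini for independent variables: one of them may be frozen while the other is integrated. -/
theorem lintegral_comp_of_indepFun {A : Ω → S} {B : Ω → T} (hA : Measurable A)
    (hB : Measurable B) (hAB : IndepFun A B P) {F : S × T → ℝ≥0∞} (hF : Measurable F) :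
    ∫⁻ ω, F (A ω, B ω) ∂P = ∫⁻ ω, ∫⁻ ω', F (A ω, B ω') ∂P ∂P := by
  have h1 := (indepFun_iff_map_prod_eq_prod_map_map hA.aemeasurable hB.aemeasurable).1 hAB
  rw [← lintegral_map hF (hA.prodMk hB), h1, lintegral_prod _ hF.aemeasurable,
    lintegral_map (hF.lintegral_prod_right' (ν := P.map B)) hA]
  refine lintegral_congr fun ω => ?_
  rw [lintegral_map (by fun_prop) hB]

variable {μ : Measure S} {ρ : Measure T} [SFinite μ] [SFinite ρ] {X : ℕ → Ω → T} {Y : ℕ → Ω → S}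

/-- With the covariate frozen, the sum over `k` is a centred i.i.d. sum; the bound is then
integrated over the covariate. -/
theorem lintegral_sum_sq_le_of_indep (hX : ∀ i, Measurable (X i)) (hXlaw : ∀ i, P.map (X i) = ρ)
    (hY : ∀ k, Measurable (Y k)) (hYlaw : ∀ k, P.map (Y k) = μ) (hYind : iIndepFun Y P)
    (hXY : IndepFun (fun ω i => X i ω) (fun ω k => Y k ω) P)
    {φ : S → T → Par p} (hφ : Measurable fun q : S × T => φ q.1 q.2)
    (h0 : ∀ᵐ x ∂ρ, Integrable (fun y => φ y x) μ ∧ ∫ y, φ y x ∂μ = 0) (i m : ℕ) :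
    ∫⁻ ω, ‖∑ k ∈ Finset.range m, φ (Y k ω) (X i ω)‖ₑ ^ 2 ∂P ≤
      m * ∫⁻ q, ‖φ q.1 q.2‖ₑ ^ 2 ∂(μ.prod ρ) := by
  have hYs : Measurable fun ω k => Y k ω := measurable_pi_lambda _ hY
  have hind : IndepFun (X i) (fun ω k => Y k ω) P :=
    hXY.comp (measurable_pi_apply i) measurable_id
  have hF : Measurable fun q : T × (ℕ → S) => ‖∑ k ∈ Finset.range m, φ (q.2 k) q.1‖ₑ ^ 2 := by
    refine (Finset.measurable_sum _ fun k _ => ?_).enorm.pow_const 2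
    have hk : Measurable fun q : T × (ℕ → S) => (q.2 k, q.1) := by fun_prop
    exact hφ.comp hk
  rw [lintegral_comp_of_indepFun (hX i) hYs hind hF]
  have h0' : ∀ᵐ ω ∂P, Integrable (fun y => φ y (X i ω)) μ ∧ ∫ y, φ y (X i ω) ∂μ = 0 :=
    ae_of_ae_map (hX i).aemeasurable (by rw [hXlaw i]; exact h0)
  have hg : Measurable fun x => ∫⁻ y, ‖φ y x‖ₑ ^ 2 ∂μ :=
    (hφ.enorm.pow_const 2).lintegral_prod_left'
  calc ∫⁻ ω, ∫⁻ ω', ‖∑ k ∈ Finset.range m, φ (Y k ω') (X i ω)‖ₑ ^ 2 ∂P ∂P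
      ≤ ∫⁻ ω, m * ∫⁻ y, ‖φ y (X i ω)‖ₑ ^ 2 ∂μ ∂P := by
        refine lintegral_mono_ae ?_
        filter_upwards [h0'] with ω hω
        exact lintegral_sum_iid_sq_le hY hYlaw hYind
          (hφ.comp (measurable_id.prodMk measurable_const)) hω.1 hω.2 m
    _ = m * ∫⁻ q, ‖φ q.1 q.2‖ₑ ^ 2 ∂(μ.prod ρ) := by
        have hgi : Measurable fun ω => ∫⁻ y, ‖φ y (X i ω)‖ₑ ^ 2 ∂μ := hg.comp (hX i)
        have hmap := lintegral_map (μ := P) hg (hX i)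
        rw [lintegral_const_mul _ hgi, ← hmap, hXlaw i,
          lintegral_prod_symm _ (hφ.enorm.pow_const 2).aemeasurable]

/-- Second moment of a two-sample sum with a completely degenerate kernel. -/
theorem lintegral_double_sum_sq_le (hX : ∀ i, Measurable (X i)) (hXlaw : ∀ i, P.map (X i) = ρ)
    (hXind : iIndepFun X P)
    (hY : ∀ k, Measurable (Y k)) (hYlaw : ∀ k, P.map (Y k) = μ) (hYind : iIndepFun Y P)
    (hXY : IndepFun (fun ω i => X i ω) (fun ω k => Y k ω) P)
    {φ : S → T → Par p} (hφ : Measurable fun q : S × T => φ q.1 q.2)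
    (h0 : ∀ᵐ x ∂ρ, Integrable (fun y => φ y x) μ ∧ ∫ y, φ y x ∂μ = 0)
    (h0' : ∀ᵐ y ∂μ, Integrable (φ y) ρ ∧ ∫ x, φ y x ∂ρ = 0) (n m : ℕ) :
    ∫⁻ ω, ‖∑ i ∈ Finset.range n, ∑ k ∈ Finset.range m, φ (Y k ω) (X i ω)‖ₑ ^ 2 ∂P ≤
      n * m * ∫⁻ q, ‖φ q.1 q.2‖ₑ ^ 2 ∂(μ.prod ρ) := by
  have hYs : Measurable fun ω k => Y k ω := measurable_pi_lambda _ hY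
  have hXs : Measurable fun ω i => X i ω := measurable_pi_lambda _ hX
  have hF : Measurable fun q : (ℕ → T) × (ℕ → S) =>
      ‖∑ k ∈ Finset.range m, ∑ i ∈ Finset.range n, φ (q.2 k) (q.1 i)‖ₑ ^ 2 := by
    refine (Finset.measurable_sum _ fun k _ => Finset.measurable_sum _ fun i _ =>
      ?_).enorm.pow_const 2
    have hik : Measurable fun q : (ℕ → T) × (ℕ → S) => (q.2 k, q.1 i) := by fun_prop
    exact hφ.comp hik
  -- With the sample `X` frozen, `∑ i, φ y (X i)` is centred in `y`, so the sum over `k` costs a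
  -- factor `m`. After exchanging integrals, for fixed `y` the sum over `i` is centred as well and
  -- costs a factor `n`.
  simp_rw [Finset.sum_comm (s := Finset.range n)]
  rw [lintegral_comp_of_indepFun hXs hYs hXY hF]
  have h1 : ∀ᵐ ω ∂P, ∀ i, Integrable (fun y => φ y (X i ω)) μ ∧ ∫ y, φ y (X i ω) ∂μ = 0 :=
    ae_all_iff.2 fun i => ae_of_ae_map (hX i).aemeasurable (by rw [hXlaw i]; exact h0)
  have hm1 : Measurable fun q : Ω × S => ‖∑ i ∈ Finset.range n, φ q.2 (X i q.1)‖ₑ ^ 2 := by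
    refine (Finset.measurable_sum _ fun i _ => ?_).enorm.pow_const 2
    exact hφ.comp (measurable_snd.prodMk ((hX i).comp measurable_fst))
  calc ∫⁻ ω, ∫⁻ ω', ‖∑ k ∈ Finset.range m, ∑ i ∈ Finset.range n, φ (Y k ω') (X i ω)‖ₑ ^ 2 ∂P ∂P
      ≤ ∫⁻ ω, m * ∫⁻ y, ‖∑ i ∈ Finset.range n, φ y (X i ω)‖ₑ ^ 2 ∂μ ∂P := by
        refine lintegral_mono_ae ?_
        filter_upwards [h1] with ω hω
        refine lintegral_sum_iid_sq_le hY hYlaw hYind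
          (u := fun y => ∑ i ∈ Finset.range n, φ y (X i ω))
          (Finset.measurable_sum _ fun i _ => hφ.comp (measurable_id.prodMk measurable_const))
          (integrable_finsetSum _ fun i _ => (hω i).1) ?_ m
        rw [integral_finsetSum _ fun i _ => (hω i).1]
        exact Finset.sum_eq_zero fun i _ => (hω i).2
    _ = m * ∫⁻ y, ∫⁻ ω, ‖∑ i ∈ Finset.range n, φ y (X i ω)‖ₑ ^ 2 ∂P ∂μ := by
        rw [lintegral_const_mul _ hm1.lintegral_prod_right',
          lintegral_lintegral_swap hm1.aemeasurable]
    _ ≤ m * ∫⁻ y, n * ∫⁻ x, ‖φ y x‖ₑ ^ 2 ∂ρ ∂μ := by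
        refine mul_le_mul' le_rfl (lintegral_mono_ae ?_)
        filter_upwards [h0'] with y hy
        exact lintegral_sum_iid_sq_le hX hXlaw hXind
          (hφ.comp (measurable_const.prodMk measurable_id)) hy.1 hy.2 n
    _ = n * m * ∫⁻ q, ‖φ q.1 q.2‖ₑ ^ 2 ∂(μ.prod ρ) := by
        rw [lintegral_const_mul _ (hφ.enorm.pow_const 2).lintegral_prod_right',
          lintegral_prod _ (hφ.enorm.pow_const 2).aemeasurable]
        ring

end SecondMoments

/-! ### Characteristic functions of normalized sums -/

section CentralLimit

variable {Ω S : Type*} [MeasurableSpace Ω] [MeasurableSpace S] {p : ℕ}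
  {P : Measure Ω} [IsProbabilityMeasure P]

/-- The quadratic form of a matrix on Euclidean space. -/
def quad (A : Matrix (Fin p) (Fin p) ℝ) (x : Par p) : ℝ :=
  x.ofLp ⬝ᵥ A.mulVec x.ofLp

theorem continuous_quad (A : Matrix (Fin p) (Fin p) ℝ) : Continuous (quad A) := by
  unfold quad
  fun_prop

theorem quad_smul (A : Matrix (Fin p) (Fin p) ℝ) (c : ℝ) (x : Par p) :
    quad A (c • x) = c ^ 2 * quad A x := by
  simp [quad, Matrix.mulVec_smul]
  ring

theorem variance_inner_eq_quad {μ : Measure S} [IsProbabilityMeasure μ] {u : S → Par p}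
    (hu : MemLp u 2 μ) (a : Par p) :
    variance (fun y => inner ℝ (u y) a) μ = quad (covMat μ u) a := by
  have hr : ∀ r, MemLp (fun y => u y r) 2 μ := fun r =>
    (EuclideanSpace.proj (𝕜 := ℝ) r).comp_memLp' hu
  have h1 : (fun y => inner ℝ (u y) a) = ∑ r, fun y => a r * u y r := by
    ext y
    simp [PiLp.inner_apply, Finset.sum_apply]
  rw [h1, variance_sum' fun r _ => (hr r).const_mul _]
  simp [quad, covMat, dotProduct, Matrix.mulVec, covariance_const_mul_left,
    covariance_const_mul_right, Finset.mul_sum]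
  refine Finset.sum_congr rfl fun r _ => Finset.sum_congr rfl fun s _ => by ring

/-- The normalized partial sums `n ^ (-1/2) ∑_{k < n} u(Y_k)`. -/
def normSum (u : S → Par p) (Y : ℕ → Ω → S) (n : ℕ) (ω : Ω) : Par p :=
  (√(n : ℝ))⁻¹ • ∑ k ∈ Finset.range n, u (Y k ω)

variable {μ : Measure S} {Y : ℕ → Ω → S} {u : S → Par p}

theorem measurable_normSum (hY : ∀ k, Measurable (Y k)) (hu : Measurable u) (n : ℕ) :
    Measurable (normSum u Y n) := by
  unfold normSum
  fun_prop

theorem charFun_map_eq {Ω : Type*} [MeasurableSpace Ω] {P : Measure Ω}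
    {X : Ω → Par p} (hX : AEMeasurable X P) (a : Par p) :
    charFun (P.map X) a = ∫ ω, Complex.exp ((inner ℝ (X ω) a : ℝ) * Complex.I) ∂P := by
  rw [charFun_apply, integral_map hX]
  exact Continuous.aestronglyMeasurable (by fun_prop)

theorem integrable_normSum {Ω : Type*} [MeasurableSpace Ω] {P : Measure Ω}
    [IsProbabilityMeasure μ] {Y : ℕ → Ω → S} (hY : ∀ k, Measurable (Y k))
    (hlaw : ∀ k, P.map (Y k) = μ)
    (hL : MemLp u 2 μ) (n : ℕ) : Integrable (normSum u Y n) P := by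
  have hs : Integrable (fun ω => ∑ k ∈ Finset.range n, u (Y k ω)) P := by
    refine integrable_finsetSum _ fun k _ => ?_
    have h1 : Integrable u (P.map (Y k)) := by
      rw [hlaw k]; exact hL.integrable (by norm_num)
    exact h1.comp_measurable (hY k)
  exact hs.smul (√(n : ℝ))⁻¹

/-- Cramér-Wold: the scalar central limit theorem for `⟨u, a⟩`, with characteristic functions
evaluated at 1. -/
theorem tendsto_charFun_normSum [IsProbabilityMeasure μ] (hY : ∀ k, Measurable (Y k))
    (hlaw : ∀ k, P.map (Y k) = μ) (hind : iIndepFun Y P) (hu : Measurable u) (hL : MemLp u 2 μ)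
    (h0 : ∫ y, u y ∂μ = 0) (a : Par p) :
    Tendsto (fun n => charFun (P.map (normSum u Y n)) a) atTop
      (𝓝 (Complex.exp (-(quad (covMat μ u) a : ℝ) / 2))) := by
  have hg : Measurable fun y => inner ℝ (u y) a := by fun_prop
  have hui : Integrable u μ := hL.integrable (by norm_num)
  have hgL : MemLp (fun y => inner ℝ (u y) a) 2 μ := hL.inner_const a
  have hXL : MemLp (fun ω => inner ℝ (u (Y 0 ω)) a) 2 P := by
    rw [← hlaw 0] at hgL
    exact hgL.comp_measurePreserving ⟨hY 0, rfl⟩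
  have hid : ∀ i, IdentDistrib (Y i) (Y 0) P P := fun i =>
    ⟨(hY i).aemeasurable, (hY 0).aemeasurable, by rw [hlaw, hlaw]⟩
  have hvar : variance (fun ω => inner ℝ (u (Y 0 ω)) a) P = quad (covMat μ u) a := by
    rw [← variance_inner_eq_quad hL, ← hlaw 0,
      variance_map (by fun_prop) (hY 0).aemeasurable]
    rfl
  have hmean : ∫ ω, inner ℝ (u (Y 0 ω)) a ∂P = 0 := by
    have h1 : ∫ y, inner ℝ (u y) a ∂μ = 0 := by
      simp_rw [real_inner_comm]
      rw [integral_inner hui, h0, inner_zero_right]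
    rw [← h1, ← hlaw 0, integral_map (hY 0).aemeasurable hg.aestronglyMeasurable]
  have hT := tendstoInDistribution_inv_sqrt_mul_sum_sub (P := P)
    (X := fun k ω => inner ℝ (u (Y k ω)) a)
    (Y := id) (P' := gaussianReal 0 (variance (fun ω => inner ℝ (u (Y 0 ω)) a) P).toNNReal)
    ⟨aemeasurable_id, Measure.map_id⟩ hXL (hind.comp _ fun _ => hg)
    (fun i => (hid i).comp hg)
  have hc := (ProbabilityMeasure.tendsto_iff_tendsto_charFun.1 hT.tendsto) 1
  simp only [ProbabilityMeasure.coe_mk, Measure.map_id, charFun_gaussianReal, hmean, hvar] at hc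
  have hq : 0 ≤ quad (covMat μ u) a := hvar ▸ variance_nonneg _ _
  convert! hc using 2 with n
  · rw [charFun_map_eq (measurable_normSum hY hu n).aemeasurable, charFun_apply, integral_map]
    · congr 1
      ext ω
      simp [normSum, inner_smul_left, sum_inner]
    · exact Measurable.aemeasurable (by fun_prop)
    · exact Continuous.aestronglyMeasurable (by fun_prop)
  · simp [hq, neg_div]

/-- The Lipschitz constant is a bound for `E ‖normSum‖`, which does not grow with `n`. This
equicontinuity is what allows the argument to move with the sample size. -/
theorem norm_charFun_normSum_sub_le [IsProbabilityMeasure μ] (hY : ∀ k, Measurable (Y k))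
    (hlaw : ∀ k, P.map (Y k) = μ) (hind : iIndepFun Y P) (hu : Measurable u) (hL : MemLp u 2 μ)
    (h0 : ∫ y, u y ∂μ = 0) :
    ∃ c : ℝ, ∀ n a b, ‖charFun (P.map (normSum u Y n)) a - charFun (P.map (normSum u Y n)) b‖ ≤
      ‖a - b‖ * c := by
  have hui : Integrable u μ := hL.integrable (by norm_num)
  have hfin := lintegral_enorm_sq_ne_top hL
  refine ⟨(1 + ∫⁻ y, ‖u y‖ₑ ^ 2 ∂μ).toReal, fun n a b => ?_⟩
  have hm := measurable_normSum hY hu n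
  have hint := integrable_normSum hY hlaw hL n
  have hle : ∫ ω, ‖normSum u Y n ω‖ ∂P ≤ (1 + ∫⁻ y, ‖u y‖ₑ ^ 2 ∂μ).toReal := by
    rw [integral_norm_eq_lintegral_enorm hint.1]
    refine ENNReal.toReal_mono (by simp [hfin]) ?_
    exact lintegral_enorm_inv_sqrt_smul_le (Finset.measurable_sum _ fun k _ => hu.comp (hY k))
      (lintegral_sum_iid_sq_le hY hlaw hind hu hui h0 n)
  have hexp : ∀ c : Par p,
      Integrable (fun ω => Complex.exp ((inner ℝ (normSum u Y n ω) c : ℝ) * Complex.I)) P := by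
    intro c
    refine Integrable.of_bound (C := 1) (Measurable.aestronglyMeasurable (by fun_prop))
      (ae_of_all _ fun ω => by rw [Complex.norm_exp_ofReal_mul_I])
  rw [charFun_map_eq hm.aemeasurable, charFun_map_eq hm.aemeasurable,
    ← integral_sub (hexp a) (hexp b)]
  calc _ ≤ ∫ ω, ‖a - b‖ * ‖normSum u Y n ω‖ ∂P := by
        refine norm_integral_le_of_norm_le (hint.norm.const_mul _) (ae_of_all _ fun ω => ?_)
        have h2 : Complex.exp ((inner ℝ (normSum u Y n ω) a : ℝ) * Complex.I) -
            Complex.exp ((inner ℝ (normSum u Y n ω) b : ℝ) * Complex.I) =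
            Complex.exp ((inner ℝ (normSum u Y n ω) b : ℝ) * Complex.I) *
            (Complex.exp (Complex.I * (inner ℝ (normSum u Y n ω) (a - b) : ℝ)) - 1) := by
          rw [mul_sub, ← Complex.exp_add, inner_sub_right]
          push_cast
          ring_nf
        rw [h2, norm_mul, Complex.norm_exp_ofReal_mul_I, one_mul]
        refine (Real.norm_exp_I_mul_ofReal_sub_one_le).trans ?_
        rw [mul_comm]
        exact norm_inner_le_norm _ _
    _ ≤ _ := by
        rw [integral_const_mul]
        gcongr

/-- The characteristic functions of the normalized sums approach the Gaussian one along bounded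
arguments. -/
theorem tendsto_charFun_normSum_sub [IsProbabilityMeasure μ] (hY : ∀ k, Measurable (Y k))
    (hlaw : ∀ k, P.map (Y k) = μ) (hind : iIndepFun Y P) (hu : Measurable u) (hL : MemLp u 2 μ)
    (h0 : ∫ y, u y ∂μ = 0) {ι : Type*} {l : Filter ι} {n : ι → ℕ} (hn : Tendsto n l atTop)
    {a : ι → Par p} {R : ℝ} (ha : ∀ᶠ i in l, ‖a i‖ ≤ R) :
    Tendsto (fun i => charFun (P.map (normSum u Y (n i))) (a i) -
      Complex.exp (-(quad (covMat μ u) (a i) : ℝ) / 2)) l (𝓝 0) := by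
  obtain ⟨c, hc⟩ := norm_charFun_normSum_sub_le hY hlaw hind hu hL h0
  -- Along an ultrafilter the bounded arguments converge to some `a₀`. Equicontinuity replaces `a i`
  -- by `a₀`, and the pointwise limit at `a₀` finishes.
  rw [tendsto_iff_ultrafilter]
  intro g hg
  obtain ⟨a₀, -, ha₀⟩ := (isCompact_closedBall (0 : Par p) R).ultrafilter_le_nhds (g.map a) (by
    rw [le_principal_iff]
    have : ∀ᶠ i in (g : Filter ι), a i ∈ Metric.closedBall (0 : Par p) R := by
      filter_upwards [hg ha] with i hi
      simpa using hi
    exact this)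
  have ha' : Tendsto a g (𝓝 a₀) := ha₀
  have h1 := (tendsto_charFun_normSum hY hlaw hind hu hL h0 a₀).comp (hn.mono_left hg)
  have h2 : Tendsto (fun i => charFun (P.map (normSum u Y (n i))) (a i) -
      charFun (P.map (normSum u Y (n i))) a₀) g (𝓝 0) := by
    have h3 : Tendsto (fun i => ‖a i - a₀‖ * c) g (𝓝 0) := by
      have := ((ha'.sub_const a₀).norm).mul_const c
      simpa using this
    exact squeeze_zero_norm (fun i => hc _ _ _) h3
  have h4 : Tendsto (fun i => Complex.exp (-(quad (covMat μ u) (a i) : ℝ) / 2)) g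
      (𝓝 (Complex.exp (-(quad (covMat μ u) a₀ : ℝ) / 2))) := by
    have hcont : Continuous fun x : Par p => Complex.exp (-(quad (covMat μ u) x : ℝ) / 2) := by
      have := continuous_quad (covMat μ u)
      fun_prop
    exact (hcont.tendsto a₀).comp ha'
  have := (h2.add h1).sub h4
  simpa using this

end CentralLimit

/-! ### Standardization by `(V/n + W/m)^(-1/2)` and the two-sample limit theorem -/

section TwoSample

variable {p : ℕ}

theorem quad_add (A B : Matrix (Fin p) (Fin p) ℝ) (x : Par p) :
    quad (A + B) x = quad A x + quad B x := by
  simp [quad, Matrix.add_mulVec]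

theorem quad_smul_left (A : Matrix (Fin p) (Fin p) ℝ) (c : ℝ) (x : Par p) :
    quad (c • A) x = c * quad A x := by
  simp [quad, Matrix.smul_mulVec]

/-- By homogeneity, the constant is the minimum of the form on the compact unit sphere. -/
theorem exists_quad_lower {A : Matrix (Fin p) (Fin p) ℝ} (hA : A.PosDef) :
    ∃ c > 0, ∀ x : Par p, c * ‖x‖ ^ 2 ≤ quad A x := by
  have hpos : ∀ x : Par p, x ≠ 0 → 0 < quad A x := fun x hx => by
    have := hA.dotProduct_mulVec_pos (x := x.ofLp) (by simpa using hx)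
    simpa [quad] using this
  rcases (Metric.sphere (0 : Par p) 1).eq_empty_or_nonempty with h | h
  -- An empty sphere means `p = 0`, where any constant serves.
  · refine ⟨1, one_pos, fun x => ?_⟩
    have hx : x = 0 := by
      by_contra hx
      have : (‖x‖⁻¹ • x) ∈ Metric.sphere (0 : Par p) 1 := by
        simp [norm_smul, hx]
      simp [h] at this
    simp [hx, quad]
  · obtain ⟨x₀, hx₀, hmin⟩ := (isCompact_sphere (0 : Par p) 1).exists_isMinOn h
      (continuous_quad A).continuousOn
    refine ⟨quad A x₀, hpos x₀ (by rintro rfl; simp at hx₀), fun x => ?_⟩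
    by_cases hx : x = 0
    · simp [hx, quad]
    have h1 : quad A x₀ ≤ quad A (‖x‖⁻¹ • x) := hmin (by simp [norm_smul, hx])
    rw [quad_smul, inv_pow] at h1
    have h2 : 0 < ‖x‖ ^ 2 := by positivity
    rwa [inv_mul_eq_div, le_div_iff₀ h2] at h1

theorem invSqrt_isHermitian (A : Matrix (Fin p) (Fin p) ℝ) : (invSqrt A).IsHermitian :=
  (Matrix.nonneg_iff_posSemidef.1 (CFC.sqrt_nonneg A⁻¹)).isHermitian

theorem invSqrt_mul_mul_invSqrt {A : Matrix (Fin p) (Fin p) ℝ} (hA : A.PosDef) :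
    invSqrt A * A * invSqrt A = 1 := by
  have hB : invSqrt A * invSqrt A = A⁻¹ := CFC.sqrt_mul_sqrt_self A⁻¹ hA.inv.posSemidef.nonneg
  have hu : IsUnit A.det := (Matrix.isUnit_iff_isUnit_det A).1 hA.isUnit
  have h1 : A * invSqrt A * invSqrt A = 1 := by
    rw [Matrix.mul_assoc, hB, Matrix.mul_nonsing_inv _ hu]
  have h2 := mul_eq_one_comm.1 h1
  rwa [← Matrix.mul_assoc] at h2

/-- Standardized vectors lie on the ellipsoid of `A`. Both the norm bound on `invSqrt` and the limit
theorem rest on this. -/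
theorem quad_invSqrt {A : Matrix (Fin p) (Fin p) ℝ} (hA : A.PosDef) (x : Par p) :
    quad A (Matrix.toEuclideanLin (invSqrt A) x) = ‖x‖ ^ 2 := by
  have hs : (invSqrt A).transpose = invSqrt A := by
    simpa [Matrix.IsHermitian] using invSqrt_isHermitian A
  have : quad A (Matrix.toEuclideanLin (invSqrt A) x) =
      x.ofLp ⬝ᵥ (invSqrt A * A * invSqrt A).mulVec x.ofLp := by
    simp only [quad, Matrix.toLpLin_apply, ← Matrix.mulVec_mulVec]
    rw [Matrix.dotProduct_mulVec x.ofLp, ← Matrix.mulVec_transpose, hs]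
  rw [this, invSqrt_mul_mul_invSqrt hA, Matrix.one_mulVec, EuclideanSpace.real_norm_sq_eq]
  simp [dotProduct, sq]

theorem inner_invSqrt (A : Matrix (Fin p) (Fin p) ℝ) (x y : Par p) :
    inner ℝ (Matrix.toEuclideanLin (invSqrt A) x) y =
      inner ℝ x (Matrix.toEuclideanLin (invSqrt A) y) := by
  have := (Matrix.isSymmetric_toEuclideanLin_iff (A := invSqrt A)).2 (invSqrt_isHermitian A)
  exact this x y

variable {V W : Matrix (Fin p) (Fin p) ℝ}

theorem posDef_weighted (hV : V.PosDef) (hW : W.PosDef) {n m : ℕ} (hn : 0 < n) (hm : 0 < m) :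
    ((n : ℝ)⁻¹ • V + (m : ℝ)⁻¹ • W).PosDef :=
  (hV.smul (by positivity)).add (hW.smul (by positivity))

/-- For `y` the image of `x`, the terms `quad V y / n` and `quad W y / m` add up to `‖x‖ ^ 2`.
Keeping only the term of the smaller sample and bounding its form from below gives the factor
`√min(n, m)`. -/
theorem exists_norm_invSqrt_le (hV : V.PosDef) (hW : W.PosDef) :
    ∃ c > 0, ∀ n m : ℕ, 0 < n → 0 < m → ∀ x : Par p,
      ‖Matrix.toEuclideanLin (invSqrt ((n : ℝ)⁻¹ • V + (m : ℝ)⁻¹ • W)) x‖ ≤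
        c * √(min n m : ℕ) * ‖x‖ := by
  obtain ⟨a, ha, hVa⟩ := exists_quad_lower hV
  obtain ⟨b, hb, hWb⟩ := exists_quad_lower hW
  have hab : 0 < min a b := lt_min ha hb
  refine ⟨(√(min a b))⁻¹, by positivity, fun n m hn hm x => ?_⟩
  set y := Matrix.toEuclideanLin (invSqrt ((n : ℝ)⁻¹ • V + (m : ℝ)⁻¹ • W)) x with hy
  have h1 : (n : ℝ)⁻¹ * quad V y + (m : ℝ)⁻¹ * quad W y = ‖x‖ ^ 2 := by
    rw [← quad_invSqrt (posDef_weighted hV hW hn hm) x, ← hy, quad_add, quad_smul_left,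
      quad_smul_left]
  have hVy : 0 ≤ quad V y := le_trans (by positivity) (hVa y)
  have hWy : 0 ≤ quad W y := le_trans (by positivity) (hWb y)
  have h2 : min a b * ‖y‖ ^ 2 ≤ (min n m : ℕ) * ‖x‖ ^ 2 := by
    have hmin : 0 < min n m := lt_min hn hm
    rcases le_total n m with h | h
    · rw [min_eq_left h]
      have : (n : ℝ)⁻¹ * quad V y ≤ ‖x‖ ^ 2 := by
        rw [← h1]; exact le_add_of_nonneg_right (by positivity)
      rw [inv_mul_le_iff₀ (by positivity)] at this
      refine le_trans ?_ ((hVa y).trans this)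
      gcongr
      exact min_le_left _ _
    · rw [min_eq_right h]
      have : (m : ℝ)⁻¹ * quad W y ≤ ‖x‖ ^ 2 := by
        rw [← h1]; exact le_add_of_nonneg_left (by positivity)
      rw [inv_mul_le_iff₀ (by positivity)] at this
      refine le_trans ?_ ((hWb y).trans this)
      gcongr
      exact min_le_right _ _
  refine (sq_le_sq₀ (by positivity) (by positivity)).1 ?_
  rw [mul_pow, mul_pow, inv_pow, Real.sq_sqrt hab.le, Real.sq_sqrt (Nat.cast_nonneg _),
    mul_assoc, le_inv_mul_iff₀ hab]
  exact h2

variable {Ω S T : Type*} [MeasurableSpace Ω] [MeasurableSpace S] [MeasurableSpace T]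
  {P : Measure Ω} [IsProbabilityMeasure P] {μ : Measure S} [IsProbabilityMeasure μ]
  {ρ : Measure T} [IsProbabilityMeasure ρ]

theorem inv_smul_sum_eq_normSum {Ω S : Type*} (u : S → Par p) (Y : ℕ → Ω → S) (n : ℕ) (ω : Ω) :
    (n : ℝ)⁻¹ • ∑ k ∈ Finset.range n, u (Y k ω) = (√(n : ℝ))⁻¹ • normSum u Y n ω := by
  rw [normSum, smul_smul, ← mul_inv, Real.mul_self_sqrt (Nat.cast_nonneg n)]

/-- Central limit theorem for the difference of two independent sample means, jointly in the two
sample sizes. -/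
theorem tendstoInDistribution_two_sample {X : ℕ → Ω → T} {Y : ℕ → Ω → S} {u : S → Par p}
    {v : T → Par p} (hX : ∀ i, Measurable (X i)) (hXlaw : ∀ i, P.map (X i) = ρ)
    (hXind : iIndepFun X P)
    (hY : ∀ k, Measurable (Y k)) (hYlaw : ∀ k, P.map (Y k) = μ) (hYind : iIndepFun Y P)
    (hXY : IndepFun (fun ω i => X i ω) (fun ω k => Y k ω) P)
    (hu : Measurable u) (huL : MemLp u 2 μ) (hu0 : ∫ y, u y ∂μ = 0)
    (hv : Measurable v) (hvL : MemLp v 2 ρ) (hv0 : ∫ x, v x ∂ρ = 0)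
    (hV : (covMat ρ v).PosDef) (hW : (covMat μ u).PosDef) :
    TendstoInDistribution
      (fun (a : ℕ × ℕ) ω => Matrix.toEuclideanLin
        (invSqrt ((a.1 : ℝ)⁻¹ • covMat ρ v + (a.2 : ℝ)⁻¹ • covMat μ u))
        ((a.2 : ℝ)⁻¹ • ∑ k ∈ Finset.range a.2, u (Y k ω) -
          (a.1 : ℝ)⁻¹ • ∑ i ∈ Finset.range a.1, v (X i ω)))
      (atTop ×ˢ atTop) id (fun _ => P) (stdGaussian (Par p)) := by
  set B : ℕ × ℕ → Par p →ₗ[ℝ] Par p := fun a => Matrix.toEuclideanLin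
    (invSqrt ((a.1 : ℝ)⁻¹ • covMat ρ v + (a.2 : ℝ)⁻¹ • covMat μ u)) with hB
  have hBm : ∀ a, Measurable (B a) := fun a =>
    (B a).continuous_of_finiteDimensional.measurable
  have hmeas : ∀ a : ℕ × ℕ, Measurable fun ω => B a
      ((a.2 : ℝ)⁻¹ • ∑ k ∈ Finset.range a.2, u (Y k ω) -
          (a.1 : ℝ)⁻¹ • ∑ i ∈ Finset.range a.1, v (X i ω)) := fun a =>
    (hBm a).comp (by fun_prop)
  refine ⟨fun a => (hmeas a).aemeasurable, aemeasurable_id, ?_⟩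
  have hchar : ∀ t : Par p, Tendsto (fun a : ℕ × ℕ => charFun (P.map fun ω => B a
      ((a.2 : ℝ)⁻¹ • ∑ k ∈ Finset.range a.2, u (Y k ω) -
          (a.1 : ℝ)⁻¹ • ∑ i ∈ Finset.range a.1, v (X i ω))) t) (atTop ×ˢ atTop)
      (𝓝 (charFun (stdGaussian (Par p)) t)) := by
    intro t
    -- By symmetry `B a` moves onto `t`, so the two independent normalized sums are tested at `α a`
    -- and `β a`; the sign in `α` is that of the subtracted mean.
    set α : ℕ × ℕ → Par p := fun a => -(√(a.1 : ℝ))⁻¹ • B a t with hα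
    set β : ℕ × ℕ → Par p := fun a => (√(a.2 : ℝ))⁻¹ • B a t with hβ
    have hprod : ∀ a : ℕ × ℕ, charFun (P.map fun ω => B a
        ((a.2 : ℝ)⁻¹ • ∑ k ∈ Finset.range a.2, u (Y k ω) -
          (a.1 : ℝ)⁻¹ • ∑ i ∈ Finset.range a.1, v (X i ω))) t =
        charFun (P.map (normSum u Y a.2)) (β a) * charFun (P.map (normSum v X a.1)) (α a) := by
      intro a
      have hmX := measurable_normSum hX hv a.1
      have hmY := measurable_normSum hY hu a.2
      have h1 : Measurable fun ω => B a ((√(a.2 : ℝ))⁻¹ • normSum u Y a.2 ω) :=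
        (hBm a).comp (by fun_prop)
      have h2 : Measurable fun ω => B a (-(√(a.1 : ℝ))⁻¹ • normSum v X a.1 ω) :=
        (hBm a).comp (by fun_prop)
      have hind : IndepFun (fun ω => B a ((√(a.2 : ℝ))⁻¹ • normSum u Y a.2 ω))
          (fun ω => B a (-(√(a.1 : ℝ))⁻¹ • normSum v X a.1 ω)) P := by
        have hφ : Measurable fun y : ℕ → S => B a ((√(a.2 : ℝ))⁻¹ • (√(a.2 : ℝ))⁻¹ •
            ∑ k ∈ Finset.range a.2, u (y k)) := (hBm a).comp (by fun_prop)
        have hψ : Measurable fun x : ℕ → T => B a (-(√(a.1 : ℝ))⁻¹ • (√(a.1 : ℝ))⁻¹ •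
            ∑ i ∈ Finset.range a.1, v (x i)) := (hBm a).comp (by fun_prop)
        exact hXY.symm.comp hφ hψ
      have hsum : (fun ω => B a ((a.2 : ℝ)⁻¹ • ∑ k ∈ Finset.range a.2, u (Y k ω) -
          (a.1 : ℝ)⁻¹ • ∑ i ∈ Finset.range a.1, v (X i ω))) = fun ω =>
          B a ((√(a.2 : ℝ))⁻¹ • normSum u Y a.2 ω) +
            B a (-(√(a.1 : ℝ))⁻¹ • normSum v X a.1 ω) := by
        ext1 ω
        rw [inv_smul_sum_eq_normSum, inv_smul_sum_eq_normSum, ← map_add, neg_smul, sub_eq_add_neg]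
      rw [hsum, hind.charFun_map_fun_add_eq_mul h1.aemeasurable h2.aemeasurable, Pi.mul_apply,
        charFun_map_eq h1.aemeasurable, charFun_map_eq h2.aemeasurable,
        charFun_map_eq hmX.aemeasurable, charFun_map_eq hmY.aemeasurable]
      simp only [hα, hβ, hB, inner_invSqrt, inner_smul_left, inner_smul_right, conj_trivial]
    obtain ⟨cv, hcv, hVl⟩ := exists_quad_lower hV
    obtain ⟨cw, hcw, hWl⟩ := exists_quad_lower hW
    -- This identity replaces any assumption on `n/m`: it bounds `α` and `β`, and it makes the
    -- product of the two Gaussian factors exactly `exp (-‖t‖ ^ 2 / 2)`.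
    have hq : ∀ᶠ a : ℕ × ℕ in atTop ×ˢ atTop,
        quad (covMat ρ v) (α a) + quad (covMat μ u) (β a) = ‖t‖ ^ 2 := by
      filter_upwards [(eventually_gt_atTop 0).prod_mk (eventually_gt_atTop 0)] with a ha
      rw [← quad_invSqrt (posDef_weighted hV hW ha.1 ha.2) t, quad_add, quad_smul_left,
        quad_smul_left, hα, hβ, quad_smul, quad_smul, neg_sq, inv_pow, inv_pow,
        Real.sq_sqrt (Nat.cast_nonneg _), Real.sq_sqrt (Nat.cast_nonneg _)]
    have hαb : ∀ᶠ a : ℕ × ℕ in atTop ×ˢ atTop, ‖α a‖ ≤ √(‖t‖ ^ 2 / cv) := by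
      filter_upwards [hq] with a ha
      refine Real.le_sqrt_of_sq_le ?_
      rw [le_div_iff₀' hcv]
      have := (by positivity : 0 ≤ cw * ‖β a‖ ^ 2).trans (hWl (β a))
      linarith [hVl (α a)]
    have hβb : ∀ᶠ a : ℕ × ℕ in atTop ×ˢ atTop, ‖β a‖ ≤ √(‖t‖ ^ 2 / cw) := by
      filter_upwards [hq] with a ha
      refine Real.le_sqrt_of_sq_le ?_
      rw [le_div_iff₀' hcw]
      have := (by positivity : 0 ≤ cv * ‖α a‖ ^ 2).trans (hVl (α a))
      linarith [hWl (β a)]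
    have h1 := tendsto_charFun_normSum_sub hX hXlaw hXind hv hvL hv0
      (tendsto_fst (f := atTop) (g := (atTop : Filter ℕ))) hαb
    have h2 := tendsto_charFun_normSum_sub hY hYlaw hYind hu huL hu0
      (tendsto_snd (f := (atTop : Filter ℕ)) (g := atTop)) hβb
    have h3 := h2.norm.add h1.norm
    rw [norm_zero, add_zero] at h3
    rw [charFun_stdGaussian, ← tendsto_sub_nhds_zero_iff]
    refine squeeze_zero_norm' ?_ h3
    filter_upwards [hq] with a ha
    have hexp : Complex.exp (-(‖t‖ : ℂ) ^ 2 / 2) =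
        Complex.exp (-(quad (covMat μ u) (β a) : ℝ) / 2) *
          Complex.exp (-(quad (covMat ρ v) (α a) : ℝ) / 2) := by
      rw [← Complex.exp_add, ← Complex.ofReal_pow, ← ha]
      push_cast
      ring_nf
    have hPX := Measure.isProbabilityMeasure_map (μ := P)
      (measurable_normSum hX hv a.1).aemeasurable
    have hPY := Measure.isProbabilityMeasure_map (μ := P)
      (measurable_normSum hY hu a.2).aemeasurable
    have hX1 : ‖charFun (P.map (normSum v X a.1)) (α a)‖ ≤ 1 := norm_charFun_le_one _
    have hY1 : ‖Complex.exp (-(quad (covMat μ u) (β a) : ℝ) / 2)‖ ≤ 1 := by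
      have h0 := (by positivity : 0 ≤ cw * ‖β a‖ ^ 2).trans (hWl (β a))
      rw [Complex.norm_exp]
      refine Real.exp_le_one_iff.2 ?_
      have : (-(quad (covMat μ u) (β a) : ℂ) / 2).re = -quad (covMat μ u) (β a) / 2 := by
        rw [← Complex.ofReal_neg, ← Complex.ofReal_ofNat, ← Complex.ofReal_div, Complex.ofReal_re]
      rw [this]
      linarith
    rw [hprod, hexp]
    generalize charFun (P.map (normSum v X a.1)) (α a) = x at *
    generalize charFun (P.map (normSum u Y a.2)) (β a) = y at *
    generalize Complex.exp (-(quad (covMat μ u) (β a) : ℝ) / 2) = y' at *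
    generalize Complex.exp (-(quad (covMat ρ v) (α a) : ℝ) / 2) = x' at *
    calc ‖y * x - y' * x'‖ = ‖(y - y') * x + y' * (x - x')‖ := by ring_nf
      _ ≤ ‖y - y'‖ * ‖x‖ + ‖y'‖ * ‖x - x'‖ := by
          refine (norm_add_le _ _).trans ?_
          rw [norm_mul, norm_mul]
      _ ≤ ‖y - y'‖ * 1 + 1 * ‖x - x'‖ := by gcongr
      _ = _ := by ring
  -- Lévy's continuity theorem is applied along sequences of pairs of sample sizes.
  refine tendsto_of_seq_tendsto fun s hs => ?_
  refine ProbabilityMeasure.tendsto_iff_tendsto_charFun.2 fun t => ?_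
  simp only [ProbabilityMeasure.coe_mk]
  rw [Measure.map_id]
  exact (hchar t).comp hs

end TwoSample

/-! ### Measurability of gradients and Jensen's inequality -/

section Regularity

variable {S : Type*} [MeasurableSpace S] {p : ℕ}

/-- Each partial derivative is a pointwise limit of the difference quotients with step `1 / n`. -/
theorem measurable_gradient_param {F : S → Par p → ℝ} {θ : Par p}
    (hF : ∀ t, Measurable fun s => F s t) (hd : ∀ s, DifferentiableAt ℝ (F s) θ) :
    Measurable fun s => ∇ (F s) θ := by
  have hr : ∀ r, Measurable fun s => (∇ (F s) θ) r := by
    intro r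
    have hlim : Tendsto (fun (n : ℕ) s => (n : ℝ) •
        (F s (θ + (n : ℝ)⁻¹ • EuclideanSpace.single r 1) - F s θ)) atTop
        (𝓝 fun s => (∇ (F s) θ) r) := by
      rw [tendsto_pi_nhds]
      intro s
      have h1 := (hd s).hasFDerivAt.lim (EuclideanSpace.single r 1) (c := fun n : ℕ => (n : ℝ))
        (l := atTop) (by simpa using tendsto_natCast_atTop_atTop)
      rw [← inner_gradient] at h1
      simpa only [Real.norm_natCast, EuclideanSpace.inner_single_right, conj_trivial,
        one_mul] using h1
    refine measurable_of_tendsto_metrizable (fun n => ?_) hlim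
    exact ((hF _).sub (hF _)).const_smul (n : ℝ)
  have : (fun s => ∇ (F s) θ) = fun s => WithLp.toLp 2 fun r => (∇ (F s) θ) r := rfl
  rw [this]
  exact (WithLp.measurable_toLp _ _).comp (measurable_pi_lambda _ hr)

theorem enorm_integral_sq_le {E : Type*} [NormedAddCommGroup E] [NormedSpace ℝ E] {μ : Measure S}
    [IsProbabilityMeasure μ] {g : S → E} (hg : AEStronglyMeasurable g μ) :
    ‖∫ x, g x ∂μ‖ₑ ^ 2 ≤ ∫⁻ x, ‖g x‖ₑ ^ 2 ∂μ := by
  have h1 : ‖∫ x, g x ∂μ‖ₑ ≤ eLpNorm g 2 μ :=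
    (enorm_integral_le_lintegral_enorm g).trans (by
      rw [← eLpNorm_one_eq_lintegral_enorm]
      exact eLpNorm_le_eLpNorm_of_exponent_le one_le_two hg)
  have h2 := eLpNorm_nnreal_pow_eq_lintegral (μ := μ) (f := g) (p := 2) two_ne_zero
  calc ‖∫ x, g x ∂μ‖ₑ ^ 2 ≤ eLpNorm g 2 μ ^ 2 := by gcongr
    _ = ∫⁻ x, ‖g x‖ₑ ^ 2 ∂μ := by
      have h3 : eLpNorm g 2 μ ^ (2 : ℝ) = ∫⁻ x, ‖g x‖ₑ ^ (2 : ℝ) ∂μ := by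
        simpa using h2
      simpa using h3

end Regularity

/-! ### The projection of a square-integrable kernel -/

section Kernel

variable {S T : Type*} [MeasurableSpace S] [MeasurableSpace T] {p : ℕ}
  {μ : Measure S} {ρ : Measure T} [IsProbabilityMeasure ρ]
  {φ : S → T → Par p}

theorem measurable_integral_right (hφ : Measurable fun q : S × T => φ q.1 q.2) :
    Measurable fun y => ∫ x, φ y x ∂ρ :=
  (hφ.stronglyMeasurable.integral_prod_right (f := φ)).measurable

/-- Jensen's inequality in `x`, then Tonelli. -/
theorem memLp_integral_right (hφ : Measurable fun q : S × T => φ q.1 q.2)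
    (hL : MemLp (fun q : S × T => φ q.1 q.2) 2 (μ.prod ρ)) :
    MemLp (fun y => ∫ x, φ y x ∂ρ) 2 μ := by
  refine memLp_two_of_lintegral_ne_top (measurable_integral_right hφ).aestronglyMeasurable ?_
  refine ne_top_of_le_ne_top (lintegral_enorm_sq_ne_top hL) ?_
  rw [lintegral_prod _ (hφ.enorm.pow_const 2).aemeasurable]
  exact lintegral_mono fun y =>
    enorm_integral_sq_le (hφ.comp (measurable_const.prodMk measurable_id)).aestronglyMeasurable

theorem integral_integral_right_eq_zero [IsProbabilityMeasure μ]
    (hL : MemLp (fun q : S × T => φ q.1 q.2) 2 (μ.prod ρ))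
    (h0 : ∀ x, ∫ y, φ y x ∂μ = 0) : ∫ y, ∫ x, φ y x ∂ρ ∂μ = 0 := by
  rw [integral_integral_swap (f := φ) (hL.integrable (by norm_num))]
  simp [h0]

end Kernel

/-! ### Smoothness and positivity of the Monte Carlo norming constant -/

section MonteCarlo

variable {𝒴 𝒳 : Type*} {p : ℕ} {f : 𝒴 → 𝒳 → Par p → ℝ} {h : 𝒴 → ℝ} {ys : ℕ → 𝒴} {m : ℕ}

theorem contDiff_mcConst (hf_smooth : ∀ y x, ContDiff ℝ 2 (f y x)) (x : 𝒳) :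
    ContDiff ℝ 2 (mcConst f h ys m x) := by
  unfold mcConst
  exact contDiff_const.mul (ContDiff.sum fun k _ => (hf_smooth (ys k) x).div_const _)

theorem mcConst_pos (hf_pos : ∀ y x θ, 0 < f y x θ) (hys : ∀ k, 0 < h (ys k)) (hm : 0 < m)
    (x : 𝒳) (θ : Par p) : 0 < mcConst f h ys m x θ :=
  mul_pos (by positivity) (Finset.sum_pos (fun k _ => div_pos (hf_pos _ _ _) (hys k))
    (Finset.nonempty_range_iff.2 hm.ne'))

theorem gradient_mcConst (hf_smooth : ∀ y x, ContDiff ℝ 2 (f y x)) (x : 𝒳) (θ : Par p) :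
    ∇ (mcConst f h ys m x) θ =
      (m : ℝ)⁻¹ • ∑ k ∈ Finset.range m, (h (ys k))⁻¹ • ∇ (f (ys k) x) θ := by
  have h1 : mcConst f h ys m x = fun t =>
      (m : ℝ)⁻¹ * ∑ k ∈ Finset.range m, (h (ys k))⁻¹ * f (ys k) x t := by
    ext t
    simp [mcConst, div_eq_inv_mul]
  rw [h1, gradient_const_mul, gradient_sum _ fun k _ =>
    ((hf_smooth (ys k) x).differentiable two_ne_zero θ).const_mul _]
  simp_rw [gradient_const_mul]

end MonteCarlo

/-! ### The norming constant, the score and the kernel `φ` -/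

section Model

variable {𝒴 𝒳 : Type*} [MeasurableSpace 𝒴] {p : ℕ}
  {ν : Measure 𝒴} {f : 𝒴 → 𝒳 → Par p → ℝ} {h : 𝒴 → ℝ} {θ : Par p}

theorem ne_zero_of_instrLaw [IsProbabilityMeasure (instrLaw ν h)] : ν ≠ 0 := by
  rintro rfl
  have := measure_univ (μ := instrLaw (0 : Measure 𝒴) h)
  simp [instrLaw] at this

theorem normConst_pos (hν : ν ≠ 0) (hf_pos : ∀ y x θ, 0 < f y x θ)
    (hint : ∀ x, DiffUnderIntegral ν f x) (x : 𝒳) (θ : Par p) : 0 < normConst ν f x θ := by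
  refine (integral_pos_iff_support_of_nonneg (fun y => (hf_pos y x θ).le)
    ((hint x).integrable θ)).2 ?_
  have : Function.support (fun y => f y x θ) = Set.univ :=
    Set.eq_univ_of_forall fun y => (hf_pos y x θ).ne'
  rw [this]
  exact Measure.measure_univ_pos.2 hν

theorem differentiable_normConst (hint : ∀ x, DiffUnderIntegral ν f x) (x : 𝒳) :
    Differentiable ℝ (normConst ν f x) :=
  fun θ => ((hint x).hasGradientAt θ).differentiableAt

theorem measurable_normConst [MeasurableSpace 𝒳] [SFinite ν]
    (hf : ∀ θ, Measurable fun z : 𝒴 × 𝒳 => f z.1 z.2 θ)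
    (θ : Par p) : Measurable fun x => normConst ν f x θ :=
  ((hf θ).stronglyMeasurable.integral_prod_left (f := fun y x => f y x θ)).measurable

theorem logDens_eq (hf_pos : ∀ y x θ, 0 < f y x θ) (hC : ∀ x θ, 0 < normConst ν f x θ)
    (y : 𝒴) (x : 𝒳) :
    logDens ν f y x = fun t => Real.log (f y x t) - Real.log (normConst ν f x t) :=
  funext fun t => Real.log_div (hf_pos y x t).ne' (hC x t).ne'

theorem differentiable_logDens (hf_pos : ∀ y x θ, 0 < f y x θ)
    (hf_smooth : ∀ y x, ContDiff ℝ 2 (f y x)) (hC : ∀ x θ, 0 < normConst ν f x θ)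
    (hint : ∀ x, DiffUnderIntegral ν f x) (y : 𝒴) (x : 𝒳) :
    Differentiable ℝ (logDens ν f y x) := by
  rw [logDens_eq hf_pos hC]
  exact (((hf_smooth y x).differentiable two_ne_zero).log fun t => (hf_pos y x t).ne').sub
    ((differentiable_normConst hint x).log fun t => (hC x t).ne')

theorem gradient_logDens (hf_pos : ∀ y x θ, 0 < f y x θ)
    (hf_smooth : ∀ y x, ContDiff ℝ 2 (f y x)) (hC : ∀ x θ, 0 < normConst ν f x θ)
    (hint : ∀ x, DiffUnderIntegral ν f x) (y : 𝒴) (x : 𝒳) :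
    ∇ (logDens ν f y x) = fun t =>
      ∇ (fun s => Real.log (f y x s)) t - ∇ (fun s => Real.log (normConst ν f x s)) t := by
  rw [logDens_eq hf_pos hC]
  ext1 t
  exact gradient_sub
    ((((hf_smooth y x).differentiable two_ne_zero).log fun t => (hf_pos y x t).ne') t)
    (((differentiable_normConst hint x).log fun t => (hC x t).ne') t)

theorem differentiable_gradient_log_normConst (hC : ∀ x θ, 0 < normConst ν f x θ)
    (hint : ∀ x, DiffUnderIntegral ν f x) (x : 𝒳) :
    Differentiable ℝ (∇ fun s => Real.log (normConst ν f x s)) := fun t =>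
  (hasFDerivAt_gradient_log (differentiable_normConst hint x) (fun s => (hC x s).ne')
    ((hint x).differentiableAt_grad t)).differentiableAt

theorem differentiable_gradient_logDens (hf_pos : ∀ y x θ, 0 < f y x θ)
    (hf_smooth : ∀ y x, ContDiff ℝ 2 (f y x)) (hC : ∀ x θ, 0 < normConst ν f x θ)
    (hint : ∀ x, DiffUnderIntegral ν f x) (y : 𝒴) (x : 𝒳) :
    Differentiable ℝ (∇ (logDens ν f y x)) := by
  rw [gradient_logDens hf_pos hf_smooth hC hint]
  refine Differentiable.sub (fun t => ?_) (differentiable_gradient_log_normConst hC hint x)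
  exact (hasFDerivAt_gradient_log ((hf_smooth y x).differentiable two_ne_zero)
    (fun s => (hf_pos y x s).ne') (differentiable_gradient (hf_smooth y x) t)).differentiableAt

theorem measurable_logDens [MeasurableSpace 𝒳] [SFinite ν]
    (hf : ∀ θ, Measurable fun z : 𝒴 × 𝒳 => f z.1 z.2 θ)
    (θ : Par p) : Measurable fun z : 𝒴 × 𝒳 => logDens ν f z.1 z.2 θ :=
  ((hf θ).div ((measurable_normConst hf θ).comp measurable_snd)).log

theorem measurable_score [MeasurableSpace 𝒳] [SFinite ν]
    (hf : ∀ θ, Measurable fun z : 𝒴 × 𝒳 => f z.1 z.2 θ)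
    (hd : ∀ y x, Differentiable ℝ (logDens ν f y x)) : Measurable (score ν f θ) :=
  measurable_gradient_param (F := fun z : 𝒴 × 𝒳 => logDens ν f z.1 z.2)
    (measurable_logDens hf) fun z => hd z.1 z.2 θ

theorem measurable_phi [MeasurableSpace 𝒳] [SFinite ν]
    (hf : ∀ θ, Measurable fun z : 𝒴 × 𝒳 => f z.1 z.2 θ)
    (hf_smooth : ∀ y x, ContDiff ℝ 2 (f y x)) (hint : ∀ x, DiffUnderIntegral ν f x)
    (hh : Measurable h) : Measurable fun q : 𝒴 × 𝒳 => phi ν f h θ q.1 q.2 := by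
  have h1 : Measurable fun q : 𝒴 × 𝒳 => ∇ (f q.1 q.2) θ :=
    measurable_gradient_param (F := fun z : 𝒴 × 𝒳 => f z.1 z.2) hf
      fun z => (hf_smooth z.1 z.2).differentiable two_ne_zero θ
  have h2 : Measurable fun x => ∇ (normConst ν f x) θ :=
    measurable_gradient_param (F := normConst ν f) (measurable_normConst hf)
      fun x => differentiable_normConst hint x θ
  have h3 := measurable_normConst (ν := ν) hf θ
  have h4 := hf θ
  have h5 : Measurable fun q : 𝒴 × 𝒳 => h q.1 := hh.comp measurable_fst
  have h6 : Measurable fun q : 𝒴 × 𝒳 => normConst ν f q.2 θ := h3.comp measurable_snd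
  have h7 : Measurable fun q : 𝒴 × 𝒳 => ∇ (normConst ν f q.2) θ := h2.comp measurable_snd
  exact h6.inv.smul ((h5.inv.smul h1).sub ((h4.div h5).smul (h6.inv.smul h7)))

/-- Against the density `h` the factors `1 / h` cancel, leaving `C⁻¹ • (∫ ∇ f - (∫ f) • C⁻¹ • ∇ C)`.
This is zero because `∫ f = C` and `∫ ∇ f = ∇ C`. -/
theorem phi_integrable_integral (hh : Measurable h) (hh_pos : ∀ᵐ y ∂ν, 0 < h y)
    (hC : ∀ x θ, 0 < normConst ν f x θ)
    (hint : ∀ x, DiffUnderIntegral ν f x) (x : 𝒳) :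
    Integrable (fun y => phi ν f h θ y x) (instrLaw ν h) ∧
      ∫ y, phi ν f h θ y x ∂instrLaw ν h = 0 := by
  set C := normConst ν f x θ with hCdef
  set g := ∇ (normConst ν f x) θ with hg
  have hfin : ∀ᵐ y ∂ν, ENNReal.ofReal (h y) < ∞ := ae_of_all _ fun _ => ENNReal.ofReal_lt_top
  have hae : (fun y => (ENNReal.ofReal (h y)).toReal • phi ν f h θ y x) =ᵐ[ν]
      fun y => C⁻¹ • (∇ (f y x) θ - f y x θ • C⁻¹ • g) := by
    filter_upwards [hh_pos] with y hy
    rw [ENNReal.toReal_ofReal hy.le, phi, ← hCdef, ← hg, smul_comm, smul_sub, smul_smul,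
      mul_inv_cancel₀ hy.ne', one_smul, smul_smul, mul_div_cancel₀ _ hy.ne']
  have hI1 := (hint x).integrable_grad θ
  have hI2 : Integrable (fun y => f y x θ • C⁻¹ • g) ν := ((hint x).integrable θ).smul_const _
  have hI : Integrable (fun y => C⁻¹ • (∇ (f y x) θ - f y x θ • C⁻¹ • g)) ν :=
    (hI1.sub hI2).smul C⁻¹
  refine ⟨?_, ?_⟩
  · rw [instrLaw, integrable_withDensity_iff_integrable_smul' hh.ennreal_ofReal hfin]
    exact hI.congr hae.symm
  · rw [instrLaw, integral_withDensity_eq_integral_toReal_smul hh.ennreal_ofReal hfin,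
      integral_congr_ae hae, integral_smul, integral_sub hI1 hI2, integral_smul_const,
      ← ((hint x).hasGradientAt θ).gradient, ← hg]
    have : ∫ y, f y x θ ∂ν = C := rfl
    rw [this, smul_smul, mul_inv_cancel₀ (hC x θ).ne', one_smul, sub_self, smul_zero]

variable {ys : ℕ → 𝒴} {m : ℕ}

/-- The error of the Monte Carlo score in terms of the sample mean of `φ`. -/
theorem gradient_log_mcConst_sub (hf_smooth : ∀ y x, ContDiff ℝ 2 (f y x))
    (hC : ∀ x θ, 0 < normConst ν f x θ) (hint : ∀ x, DiffUnderIntegral ν f x)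
    {x : 𝒳} (hm : mcConst f h ys m x θ ≠ 0) :
    ∇ (fun t => Real.log (mcConst f h ys m x t)) θ -
        ∇ (fun t => Real.log (normConst ν f x t)) θ =
      (normConst ν f x θ / mcConst f h ys m x θ) •
        (m : ℝ)⁻¹ • ∑ k ∈ Finset.range m, phi ν f h θ (ys k) x := by
  rw [gradient_log ((contDiff_mcConst hf_smooth x).differentiable two_ne_zero θ) hm,
    gradient_log (differentiable_normConst hint x θ) (hC x θ).ne']
  set C := normConst ν f x θ with hCdef
  set g := ∇ (normConst ν f x) θ with hg
  have hC0 : C ≠ 0 := (hC x θ).ne'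
  -- `φ` is linear in `(f / h, ∇ f / h)`, so averaging it puts `C_m` and `∇ C_m` in their places;
  -- the factor `C / C_m` then gives the difference of log-gradients without remainder.
  have h1 : (m : ℝ)⁻¹ • ∑ k ∈ Finset.range m, phi ν f h θ (ys k) x =
      C⁻¹ • (∇ (mcConst f h ys m x) θ - mcConst f h ys m x θ • C⁻¹ • g) := by
    rw [gradient_mcConst hf_smooth, mcConst]
    simp only [phi, ← hCdef, ← hg]
    rw [← Finset.smul_sum, Finset.sum_sub_distrib, ← Finset.sum_smul, smul_comm, smul_sub,
      smul_smul (m : ℝ)⁻¹ (∑ k ∈ Finset.range m, f (ys k) x θ / h (ys k))]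
  rw [h1, smul_smul, smul_sub, smul_smul, smul_smul]
  congr 2 <;> field_simp

end Model

/-! ### Expansion of the Monte Carlo score at a maximizer -/

section Expansion

theorem forall_lt_of_iSup_ofReal_lt {ι : Type*} {g : ι → ℝ} {ε : ℝ}
    (h : ⨆ i, ENNReal.ofReal (g i) < ENNReal.ofReal ε) (i : ι) : g i < ε :=
  (ENNReal.ofReal_lt_ofReal_iff'.1 ((le_iSup (fun i => ENNReal.ofReal (g i)) i).trans_lt h)).1

theorem forall_mem_lt_of_iSup_ofReal_lt {ι : Type*} {s : Set ι} {g : ι → ℝ} {ε : ℝ}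
    (h : ⨆ i ∈ s, ENNReal.ofReal (g i) < ENNReal.ofReal ε) : ∀ i ∈ s, g i < ε := fun i hi =>
  (ENNReal.ofReal_lt_ofReal_iff'.1
    ((le_iSup₂ (f := fun i (_ : i ∈ s) => ENNReal.ofReal (g i)) i hi).trans_lt h)).1

variable {p : ℕ}

/-- The mean value inequality twice, on the ball of radius `‖θ - θ₀‖`. This loses the factor 1/2 of
Taylor's formula, which is immaterial here. -/
theorem abs_taylor_le {F : Par p → ℝ} (hF : Differentiable ℝ F) (hF' : Differentiable ℝ (∇ F))
    {θ₀ : Par p} {r c : ℝ} (h : ∀ θ ∈ Metric.closedBall θ₀ r, ‖fderiv ℝ (∇ F) θ‖ ≤ c)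
    {θ : Par p} (hθ : θ ∈ Metric.closedBall θ₀ r) :
    |F θ - F θ₀ - inner ℝ (∇ F θ₀) (θ - θ₀)| ≤ c * ‖θ - θ₀‖ ^ 2 := by
  have hr : 0 ≤ r := dist_nonneg.trans hθ
  have hc : 0 ≤ c := (norm_nonneg _).trans (h θ₀ (Metric.mem_closedBall_self hr))
  have hsub : Metric.closedBall θ₀ ‖θ - θ₀‖ ⊆ Metric.closedBall θ₀ r :=
    Metric.closedBall_subset_closedBall (by simpa [dist_eq_norm] using hθ)
  have h0 : θ₀ ∈ Metric.closedBall θ₀ ‖θ - θ₀‖ := Metric.mem_closedBall_self (norm_nonneg _)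
  have h1 : ∀ x ∈ Metric.closedBall θ₀ ‖θ - θ₀‖,
      ‖fderiv ℝ F x - fderiv ℝ F θ₀‖ ≤ c * ‖θ - θ₀‖ := by
    intro x hx
    have h2 : ‖fderiv ℝ F x - fderiv ℝ F θ₀‖ = ‖∇ F x - ∇ F θ₀‖ := by
      simp only [gradient, ← map_sub, LinearIsometryEquiv.norm_map]
    rw [h2]
    refine ((convex_closedBall θ₀ r).norm_image_sub_le_of_norm_fderiv_le (fun x _ => hF' x) h
      (hsub h0) (hsub hx)).trans ?_
    gcongr
    exact mem_closedBall_iff_norm.1 hx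
  have h3 := (convex_closedBall θ₀ ‖θ - θ₀‖).norm_image_sub_le_of_norm_hasFDerivWithin_le'
    (fun x _ => (hF x).hasFDerivAt.hasFDerivWithinAt) h1 h0 (mem_closedBall_iff_norm.2 le_rfl)
  rw [inner_gradient, ← Real.norm_eq_abs]
  refine h3.trans (le_of_eq (by ring))

variable {𝒴 𝒳 : Type*} [MeasurableSpace 𝒴] {ν : Measure 𝒴} {f : 𝒴 → 𝒳 → Par p → ℝ} {h : 𝒴 → ℝ}
  {zs : ℕ → 𝒴 × 𝒳} {ys : ℕ → 𝒴} {n m : ℕ}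

theorem avgLogLik_eq (hf_pos : ∀ y x θ, 0 < f y x θ) (hC : ∀ x θ, 0 < normConst ν f x θ) :
    avgLogLik ν f zs n = fun θ =>
      (n : ℝ)⁻¹ * ∑ i ∈ Finset.range n, logDens ν f (zs i).1 (zs i).2 θ := by
  ext θ
  simp only [avgLogLik, logDens_eq hf_pos hC]

theorem gradient_avgLogLik (hf_pos : ∀ y x θ, 0 < f y x θ)
    (hf_smooth : ∀ y x, ContDiff ℝ 2 (f y x)) (hC : ∀ x θ, 0 < normConst ν f x θ)
    (hint : ∀ x, DiffUnderIntegral ν f x) :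
    ∇ (avgLogLik ν f zs n) = fun θ =>
      (n : ℝ)⁻¹ • ∑ i ∈ Finset.range n, ∇ (logDens ν f (zs i).1 (zs i).2) θ := by
  ext1 θ
  rw [avgLogLik_eq hf_pos hC, gradient_const_mul, gradient_sum _ fun i _ =>
    differentiable_logDens hf_pos hf_smooth hC hint _ _ θ]

theorem differentiable_avgLogLik (hf_pos : ∀ y x θ, 0 < f y x θ)
    (hf_smooth : ∀ y x, ContDiff ℝ 2 (f y x)) (hC : ∀ x θ, 0 < normConst ν f x θ)
    (hint : ∀ x, DiffUnderIntegral ν f x) : Differentiable ℝ (avgLogLik ν f zs n) := by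
  rw [avgLogLik_eq hf_pos hC]
  exact (Differentiable.fun_sum fun i _ =>
    differentiable_logDens hf_pos hf_smooth hC hint _ _).const_mul _

theorem differentiable_gradient_avgLogLik (hf_pos : ∀ y x θ, 0 < f y x θ)
    (hf_smooth : ∀ y x, ContDiff ℝ 2 (f y x)) (hC : ∀ x θ, 0 < normConst ν f x θ)
    (hint : ∀ x, DiffUnderIntegral ν f x) : Differentiable ℝ (∇ (avgLogLik ν f zs n)) := by
  rw [gradient_avgLogLik hf_pos hf_smooth hC hint]
  exact (Differentiable.fun_sum fun i _ =>
    differentiable_gradient_logDens hf_pos hf_smooth hC hint _ _).const_smul (n : ℝ)⁻¹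

/-- The first-order expansion of the Monte Carlo score at a maximizer of the Monte Carlo
log-likelihood. -/
theorem norm_expansion_le (hf_pos : ∀ y x θ, 0 < f y x θ)
    (hf_smooth : ∀ y x, ContDiff ℝ 2 (f y x)) (hC : ∀ x θ, 0 < normConst ν f x θ)
    (hint : ∀ x, DiffUnderIntegral ν f x) (hys : ∀ k, 0 < h (ys k)) (hm : 0 < m)
    {θ₀ θ₁ : Par p} {r ε : ℝ} {D : Par p → Matrix (Fin p) (Fin p) ℝ}
    (hlog : ∀ x, ∀ θ ∈ Metric.closedBall θ₀ r,
      ‖fderiv ℝ (∇ fun t => Real.log (mcConst f h ys m x t)) θ -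
        fderiv ℝ (∇ fun t => Real.log (normConst ν f x t)) θ‖ ≤ ε)
    (hlik : ∀ θ ∈ Metric.closedBall θ₀ r, frob (hess (avgLogLik ν f zs n) θ - D θ) ≤ ε)
    (hD : ∀ θ ∈ Metric.closedBall θ₀ r, frob (D θ - D θ₀) ≤ ε)
    (hθ₁ : θ₁ ∈ Metric.closedBall θ₀ r)
    (hmax : IsMaxOn (mcLogLik f h zs ys n m) Set.univ θ₁) :
    ‖Matrix.toEuclideanLin (D θ₀) (θ₁ - θ₀) +
        ((n : ℝ)⁻¹ • ∑ i ∈ Finset.range n, score ν f θ₀ (zs i) -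
        (n : ℝ)⁻¹ • ∑ i ∈ Finset.range n,
          (normConst ν f (zs i).2 θ₀ / mcConst f h ys m (zs i).2 θ₀) •
            (m : ℝ)⁻¹ • ∑ k ∈ Finset.range m, phi ν f h θ₀ (ys k) (zs i).2)‖ ≤
      3 * ε * ‖θ₁ - θ₀‖ := by
  have hmpos : ∀ x t, 0 < mcConst f h ys m x t := mcConst_pos hf_pos hys hm
  have dCm : ∀ x, Differentiable ℝ (mcConst f h ys m x) := fun x =>
    (contDiff_mcConst hf_smooth x).differentiable two_ne_zero
  have dC : ∀ x, Differentiable ℝ (normConst ν f x) := differentiable_normConst hint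
  have dlCm : ∀ x, Differentiable ℝ fun t => Real.log (mcConst f h ys m x t) := fun x =>
    (dCm x).log fun t => (hmpos x t).ne'
  have dlC : ∀ x, Differentiable ℝ fun t => Real.log (normConst ν f x t) := fun x =>
    (dC x).log fun t => (hC x t).ne'
  have dgCm : ∀ x, Differentiable ℝ (∇ fun t => Real.log (mcConst f h ys m x t)) := fun x t =>
    (hasFDerivAt_gradient_log (dCm x) (fun s => (hmpos x s).ne')
      (differentiable_gradient (contDiff_mcConst hf_smooth x) t)).differentiableAt
  have dgC := differentiable_gradient_log_normConst hC hint
  have dA : Differentiable ℝ (avgLogLik ν f zs n) :=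
    differentiable_avgLogLik hf_pos hf_smooth hC hint
  have dgA : Differentiable ℝ (∇ (avgLogLik ν f zs n)) :=
    differentiable_gradient_avgLogLik hf_pos hf_smooth hC hint
  set q : ℕ → Par p → ℝ := fun i t =>
    Real.log (mcConst f h ys m (zs i).2 t) - Real.log (normConst ν f (zs i).2 t) with hq
  have dq : ∀ i, Differentiable ℝ (q i) := fun i => (dlCm _).sub (dlC _)
  set N : Par p → Par p := fun t => ∇ (avgLogLik ν f zs n) t -
    (n : ℝ)⁻¹ • ∑ i ∈ Finset.range n, (∇ (fun s => Real.log (mcConst f h ys m (zs i).2 s)) t -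
      ∇ (fun s => Real.log (normConst ν f (zs i).2 s)) t) with hN
  have hL : (fun t => (n : ℝ)⁻¹ * mcLogLik f h zs ys n m t) = fun t =>
      avgLogLik ν f zs n t - (n : ℝ)⁻¹ * ∑ i ∈ Finset.range n, q i t := by
    ext t
    simp only [mcLogLik, avgLogLik, hq, Finset.sum_sub_distrib]
    ring
  have hgL : ∀ t, ∇ (fun t => (n : ℝ)⁻¹ * mcLogLik f h zs ys n m t) t = N t := by
    intro t
    have hs : Differentiable ℝ fun t => ∑ i ∈ Finset.range n, q i t :=
      Differentiable.fun_sum fun i _ => dq i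
    rw [hL, gradient_sub (dA t) ((hs t).const_mul _), gradient_const_mul,
      gradient_sum _ fun i _ => dq i t]
    simp only [hN, hq]
    congr 3
    ext1 i
    exact gradient_sub (dlCm _ t) (dlC _ t)
  -- Fermat's rule: maximization is over the whole space, so the maximizer is interior.
  have hN1 : N θ₁ = 0 := by
    rw [← hgL, gradient]
    have hloc : IsLocalMax (fun t => (n : ℝ)⁻¹ * mcLogLik f h zs ys n m t) θ₁ := by
      refine Eventually.of_forall fun t => ?_
      have := hmax (Set.mem_univ t)
      exact mul_le_mul_of_nonneg_left this (by positivity)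
    rw [hloc.fderiv_eq_zero, map_zero]
  have hN' : ∀ t, HasFDerivAt N (fderiv ℝ (∇ (avgLogLik ν f zs n)) t -
      (n : ℝ)⁻¹ • ∑ i ∈ Finset.range n,
        (fderiv ℝ (∇ fun s => Real.log (mcConst f h ys m (zs i).2 s)) t -
          fderiv ℝ (∇ fun s => Real.log (normConst ν f (zs i).2 s)) t)) t := fun t =>
    (dgA t).hasFDerivAt.sub ((HasFDerivAt.fun_sum fun i _ =>
      (dgCm _ t).hasFDerivAt.sub (dgC _ t).hasFDerivAt).const_smul (n : ℝ)⁻¹)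
  have hr : 0 ≤ r := dist_nonneg.trans hθ₁
  have h0 : θ₀ ∈ Metric.closedBall θ₀ r := Metric.mem_closedBall_self hr
  have hε : 0 ≤ ε := (Real.sqrt_nonneg _).trans (hD θ₀ h0)
  -- One `ε` each for the exact Hessian against `D t`, for `D t` against `D θ₀`, and for the Monte
  -- Carlo correction.
  have hbound : ∀ t ∈ Metric.closedBall θ₀ r, ‖(fderiv ℝ (∇ (avgLogLik ν f zs n)) t -
      (n : ℝ)⁻¹ • ∑ i ∈ Finset.range n,
        (fderiv ℝ (∇ fun s => Real.log (mcConst f h ys m (zs i).2 s)) t -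
          fderiv ℝ (∇ fun s => Real.log (normConst ν f (zs i).2 s)) t)) -
      (Matrix.toEuclideanLin (D θ₀)).toContinuousLinearMap‖ ≤ 3 * ε := by
    intro t ht
    have h1 : ‖fderiv ℝ (∇ (avgLogLik ν f zs n)) t -
        (Matrix.toEuclideanLin (D t)).toContinuousLinearMap‖ ≤ ε :=
      (norm_fderiv_gradient_sub_toEuclideanLin_le_frob _ _ _).trans (hlik t ht)
    have h2 : ‖(Matrix.toEuclideanLin (D t)).toContinuousLinearMap -
        (Matrix.toEuclideanLin (D θ₀)).toContinuousLinearMap‖ ≤ ε := by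
      rw [← map_sub, ← map_sub]
      exact (norm_toEuclideanLin_le_frob _).trans (hD t ht)
    have h3 : ‖(n : ℝ)⁻¹ • ∑ i ∈ Finset.range n,
        (fderiv ℝ (∇ fun s => Real.log (mcConst f h ys m (zs i).2 s)) t -
          fderiv ℝ (∇ fun s => Real.log (normConst ν f (zs i).2 s)) t)‖ ≤ ε := by
      rw [norm_smul, norm_inv, Real.norm_natCast]
      refine (mul_le_mul_of_nonneg_left (norm_sum_le_of_le _ fun i _ => hlog (zs i).2 t ht)
        (by positivity)).trans ?_
      rw [Finset.sum_const, Finset.card_range, nsmul_eq_mul, ← mul_assoc]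
      exact mul_le_of_le_one_left hε (inv_mul_le_one)
    generalize (n : ℝ)⁻¹ • ∑ i ∈ Finset.range n,
        (fderiv ℝ (∇ fun s => Real.log (mcConst f h ys m (zs i).2 s)) t -
          fderiv ℝ (∇ fun s => Real.log (normConst ν f (zs i).2 s)) t) = R at *
    calc _ = ‖(fderiv ℝ (∇ (avgLogLik ν f zs n)) t -
        (Matrix.toEuclideanLin (D t)).toContinuousLinearMap) +
        ((Matrix.toEuclideanLin (D t)).toContinuousLinearMap -
        (Matrix.toEuclideanLin (D θ₀)).toContinuousLinearMap) - R‖ := by congr 1; abel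
      _ ≤ ε + ε + ε := (norm_sub_le _ _).trans
          (add_le_add ((norm_add_le _ _).trans (add_le_add h1 h2)) h3)
      _ = 3 * ε := by ring
  have key := (convex_closedBall θ₀ r).norm_image_sub_le_of_norm_hasFDerivWithin_le'
    (fun t _ => (hN' t).hasFDerivWithinAt) hbound h0 hθ₁
  have hN0 : N θ₀ = (n : ℝ)⁻¹ • ∑ i ∈ Finset.range n, score ν f θ₀ (zs i) -
      (n : ℝ)⁻¹ • ∑ i ∈ Finset.range n,
        (normConst ν f (zs i).2 θ₀ / mcConst f h ys m (zs i).2 θ₀) •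
          (m : ℝ)⁻¹ • ∑ k ∈ Finset.range m, phi ν f h θ₀ (ys k) (zs i).2 := by
    simp only [hN, gradient_avgLogLik hf_pos hf_smooth hC hint, score]
    congr 3
    ext1 i
    exact gradient_log_mcConst_sub hf_smooth hC hint (hmpos _ _).ne'
  rw [hN1, ← norm_neg] at key
  rw [← hN0]
  refine le_trans (le_of_eq ?_) key
  congr 1
  simp only [LinearMap.coe_toContinuousLinearMap']
  abel

end Expansion

/-! ### Vanishing of the expected score at the Kullback-Leibler projection -/

section Stationarity

variable {𝒴 𝒳 Ω : Type*} [MeasurableSpace 𝒴] [MeasurableSpace 𝒳] [MeasurableSpace Ω] {p : ℕ}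
  {ν : Measure 𝒴} [SigmaFinite ν] {f : 𝒴 → 𝒳 → Par p → ℝ} {G : Measure (𝒴 × 𝒳)}
  {P : Measure Ω} [IsProbabilityMeasure P] {Z : ℕ → Ω → 𝒴 × 𝒳}

theorem withHighProb_mean {S E : Type*} [MeasurableSpace S] [NormedAddCommGroup E]
    [NormedSpace ℝ E] [CompleteSpace E] [MeasurableSpace E] [BorelSpace E]
    [SecondCountableTopology E] {μ : Measure S} {Y : ℕ → Ω → S} (hY : ∀ i, Measurable (Y i))
    (hlaw : ∀ i, P.map (Y i) = μ) (hind : iIndepFun Y P) {u : S → E} (hu : Measurable u)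
    (hui : Integrable u μ) {ε : ℝ} (hε : 0 < ε) :
    WithHighProb P atTop fun (n : ℕ) ω =>
      ‖(n : ℝ)⁻¹ • ∑ i ∈ Finset.range n, u (Y i ω) - ∫ y, u y ∂μ‖ < ε := by
  have hid : ∀ i, IdentDistrib (Y i) (Y 0) P P := fun i =>
    ⟨(hY i).aemeasurable, (hY 0).aemeasurable, by rw [hlaw, hlaw]⟩
  have hint : Integrable (fun ω => u (Y 0 ω)) P :=
    Integrable.comp_measurable (by rw [hlaw]; exact hui) (hY 0)
  have hmean : ∫ ω, u (Y 0 ω) ∂P = ∫ y, u y ∂μ := by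
    rw [← hlaw 0, integral_map (hY 0).aemeasurable hu.aestronglyMeasurable]
  have := strong_law_ae (μ := P) (fun i ω => u (Y i ω)) hint
    (fun i j hij => (hind.indepFun hij).comp hu hu) (fun i => (hid i).comp hu)
  rw [hmean] at this
  refine withHighProb_of_tendsto_ae (fun n => ?_) this hε
  exact Measurable.aestronglyMeasurable
    ((Finset.measurable_sum _ fun i _ => hu.comp (hY i)).const_smul (n : ℝ)⁻¹)

theorem exists_frob_sub_le {D : Par p → Matrix (Fin p) (Fin p) ℝ} {θ₀ : Par p}
    (hD : ContinuousAt D θ₀) {ε δ : ℝ} (hε : 0 < ε) (hδ : 0 < δ) :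
    ∃ r > 0, r ≤ δ ∧ ∀ θ ∈ Metric.closedBall θ₀ r, frob (D θ - D θ₀) ≤ ε := by
  have h1 : ContinuousAt (fun θ => frob (D θ - D θ₀)) θ₀ :=
    continuous_frob.continuousAt.comp (hD.sub continuousAt_const)
  have h2 : frob (D θ₀ - D θ₀) < ε := by simpa [frob] using hε
  obtain ⟨r, hr, hball⟩ := Metric.eventually_nhds_iff_ball.1 (h1.eventually (gt_mem_nhds h2))
  refine ⟨min (r / 2) δ, by positivity, min_le_right _ _, fun θ hθ => (hball θ ?_).le⟩
  have h3 : dist θ θ₀ ≤ r / 2 := (Metric.mem_closedBall.1 hθ).trans (min_le_left _ _)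
  exact Metric.mem_ball.2 (h3.trans_lt (half_lt_self hr))

/-- The score has mean zero at the Kullback-Leibler projection. -/
theorem integral_score_eq_zero
    (hf_meas : ∀ θ, Measurable fun z : 𝒴 × 𝒳 => f z.1 z.2 θ) (hf_pos : ∀ y x θ, 0 < f y x θ)
    (hf_smooth : ∀ y x, ContDiff ℝ 2 (f y x)) (hC : ∀ x θ, 0 < normConst ν f x θ)
    (hint : ∀ x, DiffUnderIntegral ν f x)
    (hZ_meas : ∀ i, Measurable (Z i)) (hZ_law : ∀ i, P.map (Z i) = G) (hZ_indep : iIndepFun Z P)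
    {θs : Par p} {δ : ℝ} (hδ : 0 < δ)
    (hKL_int : ∀ θ ∈ Metric.closedBall θs δ,
      Integrable (fun z : 𝒴 × 𝒳 => logDens ν f z.1 z.2 θ) G)
    (hKL_max : ∀ θ, Integrable (fun z : 𝒴 × 𝒳 => logDens ν f z.1 z.2 θ) G →
      ∫ z, logDens ν f z.1 z.2 θ ∂G ≤ ∫ z, logDens ν f z.1 z.2 θs ∂G)
    (hscore : Integrable (score ν f θs) G) (hD : ContinuousAt (matD ν f G) θs)
    (hlik : TendstoZeroInProb P atTop fun n ω => ⨆ θ ∈ Metric.closedBall θs δ,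
      ENNReal.ofReal (frob (hess (avgLogLik ν f (fun i => Z i ω) n) θ - matD ν f G θ))) :
    ∫ z, score ν f θs z ∂G = 0 := by
  set v := ∫ z, score ν f θs z ∂G with hv
  -- Differentiation under `E_g` is not assumed. Instead, a step from `θs` along a nonzero mean
  -- score `v` is shown to raise the sample log-likelihood by more than the law of large numbers
  -- permits.
  by_contra hv0
  have hvp : 0 < ‖v‖ := norm_pos_iff.2 hv0
  obtain ⟨r, hr, hrδ, hDr⟩ := exists_frob_sub_le hD one_pos hδ
  -- Hessian bound on the ball: one unit for the deviation from `D(θ)`, one for the variation of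
  -- `D`.
  set c := frob (matD ν f G θs) + 2 with hc
  have hc0 : 0 < c := by
    have : 0 ≤ frob (matD ν f G θs) := Real.sqrt_nonneg _
    linarith
  -- The step stays in the ball, and the quadratic term takes at most a quarter of the linear gain
  -- `t * ‖v‖ ^ 2`.
  set t := min (r / ‖v‖) (1 / (4 * c)) with ht
  have ht0 : 0 < t := by positivity
  have htr : t * ‖v‖ ≤ r := (le_div_iff₀ hvp).1 (min_le_left _ _)
  have htc : c * t ≤ 1 / 4 := by
    have : t ≤ 1 / (4 * c) := min_le_right _ _
    rw [le_div_iff₀ (by positivity)] at this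
    linarith
  set θ := θs + t • v with hθ
  have hθs : θ - θs = t • v := by simp [hθ]
  have hnorm : ‖θ - θs‖ = t * ‖v‖ := by rw [hθs, norm_smul, Real.norm_of_nonneg ht0.le]
  have hθr : θ ∈ Metric.closedBall θs r := mem_closedBall_iff_norm.2 (hnorm.trans_le htr)
  have hball := Metric.closedBall_subset_closedBall hrδ (x := θs)
  -- The sampling errors total `2 * ε` from the two likelihood means and `ε * (t * ‖v‖)` from the
  -- score, which is another quarter of the gain.
  set ε := t * ‖v‖ ^ 2 / (4 * (2 + t * ‖v‖)) with hε
  have hε0 : 0 < ε := by positivity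
  have hεe : ε * (2 + t * ‖v‖) = t * ‖v‖ ^ 2 / 4 := by rw [hε]; field_simp
  have hdiff := differentiable_logDens hf_pos hf_smooth hC hint
  have e1 := withHighProb_mean hZ_meas hZ_law hZ_indep (measurable_logDens hf_meas θ)
    (hKL_int θ (hball hθr)) hε0
  have e2 := withHighProb_mean hZ_meas hZ_law hZ_indep (measurable_logDens hf_meas θs)
    (hKL_int θs (Metric.mem_closedBall_self hδ.le)) hε0
  have e3 := withHighProb_mean hZ_meas hZ_law hZ_indep (measurable_score hf_meas hdiff) hscore hε0
  have e4 := hlik.withHighProb (ε := ENNReal.ofReal 1) (by simp)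
  -- A single sample on which all the approximations hold is enough for the contradiction.
  obtain ⟨n, ω, -, ⟨h1, h2⟩, h3, h4⟩ := ((e1.and e2).and (e3.and e4)).exists
    (Eventually.of_forall fun _ => trivial)
  have h4' := forall_mem_lt_of_iSup_ofReal_lt h4
  have hbound : ∀ x ∈ Metric.closedBall θs r,
      ‖fderiv ℝ (∇ (avgLogLik ν f (fun i => Z i ω) n)) x‖ ≤ c := by
    intro x hx
    have b1 := (norm_fderiv_gradient_sub_toEuclideanLin_le_frob _ _ _).trans (h4' x (hball hx)).le
    have b2 : ‖(Matrix.toEuclideanLin (matD ν f G x)).toContinuousLinearMap -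
        (Matrix.toEuclideanLin (matD ν f G θs)).toContinuousLinearMap‖ ≤ 1 := by
      rw [← map_sub, ← map_sub]
      exact (norm_toEuclideanLin_le_frob _).trans (hDr x hx)
    have b3 := norm_toEuclideanLin_le_frob (matD ν f G θs)
    have b4 := norm_le_norm_add_norm_sub'
      (fderiv ℝ (∇ (avgLogLik ν f (fun i => Z i ω) n)) x)
      (Matrix.toEuclideanLin (matD ν f G x)).toContinuousLinearMap
    have b5 := norm_le_norm_add_norm_sub'
      (Matrix.toEuclideanLin (matD ν f G x)).toContinuousLinearMap
      (Matrix.toEuclideanLin (matD ν f G θs)).toContinuousLinearMap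
    linarith
  have htay := abs_taylor_le (differentiable_avgLogLik hf_pos hf_smooth hC hint)
    (differentiable_gradient_avgLogLik hf_pos hf_smooth hC hint) hbound hθr
  rw [gradient_avgLogLik hf_pos hf_smooth hC hint, avgLogLik_eq hf_pos hC, hnorm, hθs] at htay
  simp only [smul_eq_mul, Real.norm_eq_abs] at h1 h2
  have hmax := hKL_max θ (hKL_int θ (hball hθr))
  have hinner : t * ‖v‖ ^ 2 - ε * (t * ‖v‖) ≤ inner ℝ ((n : ℝ)⁻¹ • ∑ i ∈ Finset.range n,
      ∇ (logDens ν f (Z i ω).1 (Z i ω).2) θs) (t • v) := by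
    have i1 : inner ℝ v (t • v) = t * ‖v‖ ^ 2 := by
      rw [inner_smul_right, real_inner_self_eq_norm_sq]
    have i2 := abs_real_inner_le_norm ((n : ℝ)⁻¹ • ∑ i ∈ Finset.range n,
      score ν f θs (Z i ω) - v) (t • v)
    rw [norm_smul, Real.norm_of_nonneg ht0.le] at i2
    have i3 : ‖(n : ℝ)⁻¹ • ∑ i ∈ Finset.range n, score ν f θs (Z i ω) - v‖ * (t * ‖v‖) ≤
        ε * (t * ‖v‖) := by gcongr
    rw [inner_sub_left, i1] at i2
    have i4 := (abs_le.1 (i2.trans i3)).1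
    simp only [score] at i4
    linarith
  have k1 := (abs_lt.1 h1).2
  have k2 := (abs_lt.1 h2).1
  have k3 := (abs_le.1 htay).1
  have k4 : c * (t * ‖v‖) ^ 2 ≤ t * ‖v‖ ^ 2 / 4 := by
    have : c * (t * ‖v‖) ^ 2 = (c * t) * (t * ‖v‖ ^ 2) := by ring
    rw [this]
    nlinarith [mul_pos ht0 (pow_pos hvp 2)]
  nlinarith [mul_pos ht0 (pow_pos hvp 2)]

end Stationarity

/-! ### Two-sample means and their projection -/

section TwoSampleMeans

variable {Ω S T : Type*} [MeasurableSpace Ω] [MeasurableSpace S] [MeasurableSpace T] {p : ℕ}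
  {P : Measure Ω}

theorem withHighProb_of_ae {ι : Type*} {l : Filter ι} {E : Ω → Prop} (h : ∀ᵐ ω ∂P, E ω) :
    WithHighProb P l fun _ => E := by
  have : P {ω | ¬ E ω} = 0 := h
  simp only [WithHighProb, this]
  exact tendsto_const_nhds

theorem withHighProb_of_eventually {ι : Type*} {l : Filter ι} {E : ι → Ω → Prop}
    (h : ∀ᶠ i in l, ∀ ω, E i ω) : WithHighProb P l E :=
  (withHighProb_of_ae (ae_of_all P fun _ => trivial)).mono
    (h.mono fun _ hi ω _ => hi ω)

variable [IsProbabilityMeasure P] {μ : Measure S} [IsProbabilityMeasure μ] {ρ : Measure T}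
  [IsProbabilityMeasure ρ] {X : ℕ → Ω → T} {Y : ℕ → Ω → S} {φ : S → T → Par p}

/-- Each normalized inner sum has expected norm at most `1 + I`, whatever `i` and the sample sizes,
and so has their average. With the norms inside the sum, weights that are uniformly close to 1 can
be replaced by 1. -/
theorem boundedInProb_mean_norm (hX : ∀ i, Measurable (X i)) (hXlaw : ∀ i, P.map (X i) = ρ)
    (hY : ∀ k, Measurable (Y k)) (hYlaw : ∀ k, P.map (Y k) = μ) (hYind : iIndepFun Y P)
    (hXY : IndepFun (fun ω i => X i ω) (fun ω k => Y k ω) P)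
    (hφ : Measurable fun q : S × T => φ q.1 q.2)
    (hL : MemLp (fun q : S × T => φ q.1 q.2) 2 (μ.prod ρ))
    (h0 : ∀ x, Integrable (fun y => φ y x) μ ∧ ∫ y, φ y x ∂μ = 0) (l : Filter (ℕ × ℕ)) :
    BoundedInProb P l fun a ω => √(a.2 : ℝ) * ((a.1 : ℝ)⁻¹ * ∑ i ∈ Finset.range a.1,
      ‖(a.2 : ℝ)⁻¹ • ∑ k ∈ Finset.range a.2, φ (Y k ω) (X i ω)‖) := by
  set I := ∫⁻ q, ‖φ q.1 q.2‖ₑ ^ 2 ∂(μ.prod ρ) with hI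
  have hIt : I ≠ ∞ := lintegral_enorm_sq_ne_top hL
  have hm : ∀ i (a : ℕ × ℕ), Measurable fun ω =>
      ∑ k ∈ Finset.range a.2, φ (Y k ω) (X i ω) := fun i a =>
    Finset.measurable_sum _ fun k _ => hφ.comp ((hY k).prodMk (hX i))
  have heq : ∀ (a : ℕ × ℕ) ω, √(a.2 : ℝ) * ((a.1 : ℝ)⁻¹ * ∑ i ∈ Finset.range a.1,
      ‖(a.2 : ℝ)⁻¹ • ∑ k ∈ Finset.range a.2, φ (Y k ω) (X i ω)‖) =
      (a.1 : ℝ)⁻¹ * ∑ i ∈ Finset.range a.1,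
        ‖(√(a.2 : ℝ))⁻¹ • ∑ k ∈ Finset.range a.2, φ (Y k ω) (X i ω)‖ := by
    intro a ω
    rw [mul_left_comm, Finset.mul_sum]
    congr 1
    refine Finset.sum_congr rfl fun i _ => ?_
    rw [norm_smul, norm_smul, ← mul_assoc, norm_inv, norm_inv, Real.norm_natCast,
      Real.norm_of_nonneg (Real.sqrt_nonneg _)]
    congr 1
    rw [← div_eq_mul_inv, Real.sqrt_div_self', one_div]
  simp only [heq]
  refine BoundedInProb.of_lintegral_le (fun a => ?_) (C := 1 + I) (by simp [hIt]) fun a => ?_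
  · exact (Measurable.const_mul (Finset.measurable_sum _ fun i _ =>
      ((hm i a).const_smul (√(a.2 : ℝ))⁻¹).norm) _).aemeasurable
  calc ∫⁻ ω, ‖(a.1 : ℝ)⁻¹ * ∑ i ∈ Finset.range a.1,
        ‖(√(a.2 : ℝ))⁻¹ • ∑ k ∈ Finset.range a.2, φ (Y k ω) (X i ω)‖‖ₑ ∂P
      ≤ ∫⁻ ω, ‖(a.1 : ℝ)⁻¹‖ₑ * ∑ i ∈ Finset.range a.1,
        ‖(√(a.2 : ℝ))⁻¹ • ∑ k ∈ Finset.range a.2, φ (Y k ω) (X i ω)‖ₑ ∂P := by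
        refine lintegral_mono fun ω => ?_
        rw [enorm_mul]
        refine mul_le_mul' le_rfl ((enorm_sum_le _ _).trans_eq ?_)
        simp only [enorm_norm]
    _ ≤ ‖(a.1 : ℝ)⁻¹‖ₑ * ∑ i ∈ Finset.range a.1, (1 + I) := by
        have hms : ∀ i, Measurable fun ω =>
            ‖(√(a.2 : ℝ))⁻¹ • ∑ k ∈ Finset.range a.2, φ (Y k ω) (X i ω)‖ₑ := fun i =>
          ((hm i a).const_smul (√(a.2 : ℝ))⁻¹).enorm
        rw [lintegral_const_mul _ (Finset.measurable_sum _ fun i _ => hms i),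
          lintegral_finsetSum _ fun i _ => hms i]
        refine mul_le_mul' le_rfl (Finset.sum_le_sum fun i _ => ?_)
        exact lintegral_enorm_inv_sqrt_smul_le (hm i a)
          (lintegral_sum_sq_le_of_indep hX hXlaw hY hYlaw hYind hXY hφ (ae_of_all _ h0) i a.2)
    _ ≤ 1 + I := by
        rw [Finset.sum_const, Finset.card_range, nsmul_eq_mul, ← mul_assoc]
        refine mul_le_of_le_one_left' ?_
        rcases Nat.eq_zero_or_pos a.1 with h | h
        · simp [h]
        · rw [← ofReal_norm, norm_inv, Real.norm_natCast, ENNReal.ofReal_inv_of_pos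
            (by exact_mod_cast h), ENNReal.ofReal_natCast,
            ENNReal.inv_mul_cancel (by exact_mod_cast h.ne') (ENNReal.natCast_ne_top _)]

/-- The two-sample mean of a kernel with one-sided mean zero is approximated by its projection. -/
theorem withHighProb_double_mean (hX : ∀ i, Measurable (X i)) (hXlaw : ∀ i, P.map (X i) = ρ)
    (hXind : iIndepFun X P)
    (hY : ∀ k, Measurable (Y k)) (hYlaw : ∀ k, P.map (Y k) = μ) (hYind : iIndepFun Y P)
    (hXY : IndepFun (fun ω i => X i ω) (fun ω k => Y k ω) P)
    (hφ : Measurable fun q : S × T => φ q.1 q.2)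
    (hL : MemLp (fun q : S × T => φ q.1 q.2) 2 (μ.prod ρ))
    (h0 : ∀ x, Integrable (fun y => φ y x) μ ∧ ∫ y, φ y x ∂μ = 0) {ε : ℝ} (hε : 0 < ε) :
    WithHighProb P (atTop ×ˢ atTop) fun (a : ℕ × ℕ) ω => √(min a.1 a.2 : ℕ) *
      ‖(a.1 : ℝ)⁻¹ • ∑ i ∈ Finset.range a.1,
          (a.2 : ℝ)⁻¹ • ∑ k ∈ Finset.range a.2, φ (Y k ω) (X i ω) -
        (a.2 : ℝ)⁻¹ • ∑ k ∈ Finset.range a.2, ∫ x, φ (Y k ω) x ∂ρ‖ < ε := by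
  -- Removing the projection leaves a kernel centred in `x` for almost every `y`, and still centred
  -- in `y` for each `x`.
  set ψ : S → T → Par p := fun y x => φ y x - ∫ x, φ y x ∂ρ with hψdef
  have hbar := measurable_integral_right (ρ := ρ) hφ
  have hbarL := memLp_integral_right hφ hL
  have hψ : Measurable fun q : S × T => ψ q.1 q.2 := hφ.sub (hbar.comp measurable_fst)
  have hψL : MemLp (fun q : S × T => ψ q.1 q.2) 2 (μ.prod ρ) :=
    hL.sub (hbarL.comp_measurePreserving measurePreserving_fst)
  have hψ0 : ∀ᵐ x ∂ρ, Integrable (fun y => ψ y x) μ ∧ ∫ y, ψ y x ∂μ = 0 := by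
    refine ae_of_all _ fun x => ⟨(h0 x).1.sub (hbarL.integrable (by norm_num)), ?_⟩
    rw [integral_sub (h0 x).1 (hbarL.integrable (by norm_num)), (h0 x).2,
      integral_integral_right_eq_zero hL fun x => (h0 x).2, sub_zero]
  have hψ0' : ∀ᵐ y ∂μ, Integrable (ψ y) ρ ∧ ∫ x, ψ y x ∂ρ = 0 := by
    filter_upwards [(hL.integrable (by norm_num)).prod_right_ae] with y hy
    refine ⟨hy.sub (integrable_const _), ?_⟩
    rw [integral_sub hy (integrable_const _)]
    simp
  set I := ∫⁻ q, ‖ψ q.1 q.2‖ₑ ^ 2 ∂(μ.prod ρ) with hI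
  have hIt : I ≠ ∞ := lintegral_enorm_sq_ne_top hψL
  set Q : ℕ × ℕ → Ω → Par p := fun a ω => (√((a.1 * a.2 : ℕ) : ℝ))⁻¹ •
    ∑ i ∈ Finset.range a.1, ∑ k ∈ Finset.range a.2, ψ (Y k ω) (X i ω) with hQ
  have hmeas : ∀ a : ℕ × ℕ, Measurable fun ω =>
      ∑ i ∈ Finset.range a.1, ∑ k ∈ Finset.range a.2, ψ (Y k ω) (X i ω) := fun a =>
    Finset.measurable_sum _ fun i _ => Finset.measurable_sum _ fun k _ =>
      hψ.comp ((hY k).prodMk (hX i))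
  have hQb : BoundedInProb P (atTop ×ˢ atTop) fun a ω => ‖Q a ω‖ := by
    refine BoundedInProb.of_lintegral_le (fun a => ?_) (C := 1 + I) (by simp [hIt]) fun a => ?_
    · exact ((hmeas a).const_smul (√((a.1 * a.2 : ℕ) : ℝ))⁻¹).norm.aemeasurable
    · simp only [enorm_norm]
      refine lintegral_enorm_inv_sqrt_smul_le (hmeas a) ?_
      rw [Nat.cast_mul]
      exact lintegral_double_sum_sq_le hX hXlaw hXind hY hYlaw hYind hXY hψ hψ0 hψ0' a.1 a.2
  refine hQb.withHighProb_lt (fun η hη => withHighProb_of_eventually ?_) hε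
  -- Since `min(n, m) ≤ n`, the factor `√min(n, m) / √(n m)` is at most `1 / √m`.
  have hlarge : ∀ᶠ m : ℕ in atTop, (η ^ 2)⁻¹ ≤ (m : ℝ) :=
    tendsto_natCast_atTop_atTop.eventually_ge_atTop _
  filter_upwards [(eventually_gt_atTop 0).prod_mk hlarge] with a ha ω
  have ha1 : (a.1 : ℝ) ≠ 0 := by exact_mod_cast ha.1.ne'
  have heq : (a.1 : ℝ)⁻¹ • ∑ i ∈ Finset.range a.1,
        (a.2 : ℝ)⁻¹ • ∑ k ∈ Finset.range a.2, φ (Y k ω) (X i ω) -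
      (a.2 : ℝ)⁻¹ • ∑ k ∈ Finset.range a.2, ∫ x, φ (Y k ω) x ∂ρ =
      (√((a.1 * a.2 : ℕ) : ℝ))⁻¹ • Q a ω := by
    rw [hQ, smul_smul, ← mul_inv, Real.mul_self_sqrt (Nat.cast_nonneg _), Nat.cast_mul, mul_inv,
      ← smul_smul]
    simp only [hψdef, Finset.sum_sub_distrib, Finset.sum_const, Finset.card_range, smul_sub,
      ← Finset.smul_sum, ← Nat.cast_smul_eq_nsmul ℝ]
    congr 1
    rw [smul_comm (a.2 : ℝ)⁻¹ (a.1 : ℝ), smul_smul (a.1 : ℝ)⁻¹, inv_mul_cancel₀ ha1, one_smul]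
  rw [heq, norm_smul, abs_norm, ← mul_assoc]
  refine mul_le_mul_of_nonneg_right ?_ (norm_nonneg _)
  have ha2 : 1 ≤ η ^ 2 * a.2 := by
    have := ha.2
    rwa [inv_le_iff_one_le_mul₀' (by positivity)] at this
  have ha2' : 0 < (a.2 : ℝ) := by
    by_contra hc
    have : (a.2 : ℝ) ≤ 0 := not_lt.1 hc
    nlinarith [sq_nonneg η]
  have hpos : 0 < √((a.1 * a.2 : ℕ) : ℝ) := by
    have : 0 < (a.1 : ℝ) := by exact_mod_cast ha.1
    rw [Nat.cast_mul]
    positivity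
  rw [norm_inv, Real.norm_of_nonneg hpos.le, ← div_eq_mul_inv, div_le_iff₀ hpos]
  refine Real.sqrt_le_iff.2 ⟨by positivity, ?_⟩
  rw [mul_pow, Real.sq_sqrt (Nat.cast_nonneg _), Nat.cast_mul]
  have : ((min a.1 a.2 : ℕ) : ℝ) ≤ a.1 := by exact_mod_cast min_le_left _ _
  calc ((min a.1 a.2 : ℕ) : ℝ) ≤ a.1 * 1 := by linarith
    _ ≤ a.1 * (η ^ 2 * a.2) := by gcongr
    _ = _ := by ring

end TwoSampleMeans

/-! ### Asymptotic linearity of the estimator -/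

section Estimator

variable {𝒴 𝒳 Ω : Type*} [MeasurableSpace 𝒴] [MeasurableSpace Ω] {p : ℕ}
  {ν : Measure 𝒴} {f : 𝒴 → 𝒳 → Par p → ℝ} {h : 𝒴 → ℝ} {P : Measure Ω} {Y : ℕ → Ω → 𝒴}

/-- Almost surely all importance weights are positive, so `C_m > 0` for `m > 0` and its logarithm is
smooth. -/
theorem ae_forall_instr_pos (hh_pos : ∀ᵐ y ∂ν, 0 < h y)
    (hY_meas : ∀ k, Measurable (Y k)) (hY_law : ∀ k, P.map (Y k) = instrLaw ν h) :
    ∀ᵐ ω ∂P, ∀ k, 0 < h (Y k ω) := by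
  refine ae_all_iff.2 fun k => ae_of_ae_map (p := fun y => 0 < h y) (hY_meas k).aemeasurable ?_
  rw [hY_law k]
  exact (withDensity_absolutelyContinuous ν fun y => ENNReal.ofReal (h y)).ae_le hh_pos

/-- The Monte Carlo log-normalizing constants have uniformly converging second derivatives. -/
theorem withHighProb_log_mcConst (hf_pos : ∀ y x θ, 0 < f y x θ)
    (hf_smooth : ∀ y x, ContDiff ℝ 2 (f y x)) (hC : ∀ x θ, 0 < normConst ν f x θ)
    (hint : ∀ x, DiffUnderIntegral ν f x) (hpos : ∀ᵐ ω ∂P, ∀ k, 0 < h (Y k ω))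
    {θs : Par p} {δ : ℝ} (hδ : 0 < δ)
    (ha : TendstoZeroInProb P atTop fun m ω => ⨆ x : 𝒳,
      ENNReal.ofReal |mcConst f h (fun k => Y k ω) m x θs - normConst ν f x θs|)
    (hb : TendstoZeroInProb P atTop fun m ω => ⨆ x : 𝒳,
      ENNReal.ofReal ‖gradient (mcConst f h (fun k => Y k ω) m x) θs -
        gradient (normConst ν f x) θs‖)
    (hc : TendstoZeroInProb P atTop fun m ω =>
      ⨆ θ ∈ Metric.closedBall θs δ, ⨆ x : 𝒳,
      ENNReal.ofReal (frob
        (hess (mcConst f h (fun k => Y k ω) m x) θ - hess (normConst ν f x) θ)))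
    {α K : ℝ} (hα : 0 < α) (hK : ∀ x, ∀ θ ∈ Metric.closedBall θs δ,
      α ≤ normConst ν f x θ ∧ normConst ν f x θ ≤ K ∧ ‖gradient (normConst ν f x) θ‖ ≤ K ∧
      frob (hess (normConst ν f x) θ) ≤ K) {ε : ℝ} (hε : 0 < ε) :
    WithHighProb P atTop fun m ω => ∀ x, ∀ θ ∈ Metric.closedBall θs δ,
      ‖fderiv ℝ (∇ fun t => Real.log (mcConst f h (fun k => Y k ω) m x t)) θ -
        fderiv ℝ (∇ fun t => Real.log (normConst ν f x t)) θ‖ ≤ ε := by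
  obtain ⟨η, hη, hclose⟩ := exists_fderiv_gradient_log_close (p := p) (K := K) hα hε hδ.le
  have hη' : 0 < ENNReal.ofReal η := ENNReal.ofReal_pos.2 hη
  refine (((ha.withHighProb hη').and (hb.withHighProb hη')).and
    ((hc.withHighProb hη').and (withHighProb_of_ae hpos))).mono ?_
  filter_upwards [eventually_gt_atTop 0] with m hm ω
  rintro ⟨⟨e1, e2⟩, e3, e4⟩ x
  refine hclose θs _ _ ((contDiff_mcConst hf_smooth x).differentiable two_ne_zero)
    (differentiable_normConst hint x) (differentiable_gradient (contDiff_mcConst hf_smooth x))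
    (hint x).differentiableAt_grad (fun t => (mcConst_pos hf_pos e4 hm x t).ne')
    (fun t => (hC x t).ne')
    (fun θ hθ => ⟨(hK x θ hθ).1, (hK x θ hθ).2.1, (hK x θ hθ).2.2.1,
      (norm_fderiv_gradient_le_frob _ _).trans (hK x θ hθ).2.2.2⟩)
    (forall_lt_of_iSup_ofReal_lt e1 x).le (forall_lt_of_iSup_ofReal_lt e2 x).le fun θ hθ => ?_
  refine (norm_fderiv_gradient_sub_le_frob _ _ _).trans ?_
  have e5 : ⨆ x : 𝒳, ENNReal.ofReal (frob
      (hess (mcConst f h (fun k => Y k ω) m x) θ - hess (normConst ν f x) θ)) <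
      ENNReal.ofReal η :=
    (le_iSup₂ (f := fun θ (_ : θ ∈ Metric.closedBall θs δ) => ⨆ x : 𝒳, ENNReal.ofReal (frob
      (hess (mcConst f h (fun k => Y k ω) m x) θ - hess (normConst ν f x) θ))) θ hθ).trans_lt e3
  exact (forall_lt_of_iSup_ofReal_lt e5 x).le

theorem withHighProb_ratio {θs : Par p}
    (ha : TendstoZeroInProb P atTop fun m ω => ⨆ x : 𝒳,
      ENNReal.ofReal |mcConst f h (fun k => Y k ω) m x θs - normConst ν f x θs|)
    {α : ℝ} (hα : 0 < α) (hαC : ∀ x, α ≤ normConst ν f x θs) {η : ℝ} (hη : 0 < η) :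
    WithHighProb P atTop fun m ω => ∀ x,
      |normConst ν f x θs / mcConst f h (fun k => Y k ω) m x θs - 1| ≤ η := by
  -- The first bound gives `C_m > α / 2`; the second then makes the error at most `η * C_m`.
  have hκ : 0 < min (α / 2) (α / 2 * η) := by positivity
  refine (ha.withHighProb (ENNReal.ofReal_pos.2 hκ)).mono (Eventually.of_forall fun m ω e x => ?_)
  have h1 := forall_lt_of_iSup_ofReal_lt e x
  have h2 := h1.trans_le (min_le_left _ _)
  have h3 := h1.trans_le (min_le_right _ _)
  set c := mcConst f h (fun k => Y k ω) m x θs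
  have hc : α / 2 < c := by
    have := (abs_lt.1 h2).1
    linarith [hαC x]
  have hc0 : 0 < c := by linarith
  rw [div_sub_one hc0.ne', abs_div, abs_of_pos hc0, div_le_iff₀ hc0, abs_sub_comm]
  refine h3.le.trans ?_
  rw [mul_comm η]
  gcongr

/-- Root consistency implies consistency, because the rate `√(s a)` tends to infinity. -/
theorem withHighProb_estimator_close {ι : Type*} {l : Filter ι} {s : ι → ℕ}
    (hs : Tendsto s l atTop) {θhat : ι → Ω → Par p} {θs : Par p}
    (hb : BoundedInProb P l fun a ω => √(s a : ℝ) * ‖θhat a ω - θs‖) {r : ℝ} (hr : 0 < r) :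
    WithHighProb P l fun a ω => θhat a ω ∈ Metric.closedBall θs r := by
  have h1 : WithHighProb P l fun a ω => ‖θhat a ω - θs‖ < r := by
    refine hb.withHighProb_lt (fun η hη => withHighProb_of_eventually ?_) hr
    have h2 : Tendsto (fun a => √(s a : ℝ)) l atTop :=
      Real.tendsto_sqrt_atTop.comp (tendsto_natCast_atTop_atTop.comp hs)
    filter_upwards [h2.eventually_ge_atTop η⁻¹] with a ha ω
    rw [abs_of_nonneg (by positivity), ← mul_assoc]
    refine le_mul_of_one_le_left (norm_nonneg _) ?_
    rwa [inv_le_iff_one_le_mul₀' hη] at ha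
  exact h1.mono (Eventually.of_forall fun a ω hω => mem_closedBall_iff_norm.2 hω.le)

theorem tendsto_min_atTop : Tendsto (fun a : ℕ × ℕ => min a.1 a.2) (atTop ×ˢ atTop) atTop := by
  refine tendsto_atTop.2 fun b => ?_
  filter_upwards [(eventually_ge_atTop b).prod_mk (eventually_ge_atTop b)] with a ha
  exact le_min ha.1 ha.2

/-- Asymptotic linearity of the Monte Carlo maximum likelihood estimator. -/
theorem withHighProb_asymptotic_linear [MeasurableSpace 𝒳] [IsProbabilityMeasure P]
    {G : Measure (𝒴 × 𝒳)} [IsProbabilityMeasure G] [SFinite ν] {Z : ℕ → Ω → 𝒴 × 𝒳}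
    (hf_meas : ∀ θ, Measurable fun z : 𝒴 × 𝒳 => f z.1 z.2 θ) (hf_pos : ∀ y x θ, 0 < f y x θ)
    (hh_meas : Measurable h) (hh_pos : ∀ᵐ y ∂ν, 0 < h y) [IsProbabilityMeasure (instrLaw ν h)]
    (hf_smooth : ∀ y x, ContDiff ℝ 2 (f y x)) (hint : ∀ x, DiffUnderIntegral ν f x)
    (hZ_meas : ∀ i, Measurable (Z i)) (hZ_law : ∀ i, P.map (Z i) = G) (hZ_indep : iIndepFun Z P)
    (hY_meas : ∀ k, Measurable (Y k)) (hY_law : ∀ k, P.map (Y k) = instrLaw ν h)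
    (hY_indep : iIndepFun Y P)
    (hZY_indep : IndepFun (fun ω i => Z i ω) (fun ω k => Y k ω) P)
    {θs : Par p} {δ : ℝ} (hδ : 0 < δ) {θhat : ℕ → ℕ → Ω → Par p}
    (hmax : WithHighProb P (atTop ×ˢ atTop) fun (a : ℕ × ℕ) ω => IsMaxOn
        (mcLogLik f h (fun i => Z i ω) (fun k => Y k ω) a.1 a.2) Set.univ (θhat a.1 a.2 ω))
    (hroot : BoundedInProb P (atTop ×ˢ atTop) fun (a : ℕ × ℕ) ω =>
      √(min a.1 a.2 : ℕ) * ‖θhat a.1 a.2 ω - θs‖)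
    (hφL : MemLp (fun q : 𝒴 × 𝒳 => phi ν f h θs q.1 q.2) 2 ((instrLaw ν h).prod G.snd))
    (hD : ContinuousAt (matD ν f G) θs)
    (hlik : TendstoZeroInProb P atTop fun n ω => ⨆ θ ∈ Metric.closedBall θs δ,
      ENNReal.ofReal (frob (hess (avgLogLik ν f (fun i => Z i ω) n) θ - matD ν f G θ)))
    (ha : TendstoZeroInProb P atTop fun m ω => ⨆ x : 𝒳,
      ENNReal.ofReal |mcConst f h (fun k => Y k ω) m x θs - normConst ν f x θs|)
    (hb : TendstoZeroInProb P atTop fun m ω => ⨆ x : 𝒳,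
      ENNReal.ofReal ‖gradient (mcConst f h (fun k => Y k ω) m x) θs -
        gradient (normConst ν f x) θs‖)
    (hc : TendstoZeroInProb P atTop fun m ω =>
      ⨆ θ ∈ Metric.closedBall θs δ, ⨆ x : 𝒳,
      ENNReal.ofReal (frob
        (hess (mcConst f h (fun k => Y k ω) m x) θ - hess (normConst ν f x) θ)))
    {α K : ℝ} (hα : 0 < α) (hK : ∀ x, ∀ θ ∈ Metric.closedBall θs δ,
      α ≤ normConst ν f x θ ∧ normConst ν f x θ ≤ K ∧ ‖gradient (normConst ν f x) θ‖ ≤ K ∧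
      frob (hess (normConst ν f x) θ) ≤ K) {ε : ℝ} (hε : 0 < ε) :
    WithHighProb P (atTop ×ˢ atTop) fun (a : ℕ × ℕ) ω => √(min a.1 a.2 : ℕ) *
      ‖Matrix.toEuclideanLin (matD ν f G θs) (θhat a.1 a.2 ω - θs) -
        ((a.2 : ℝ)⁻¹ • ∑ k ∈ Finset.range a.2, phiBar ν f h G θs (Y k ω) -
          (a.1 : ℝ)⁻¹ • ∑ i ∈ Finset.range a.1, score ν f θs (Z i ω))‖ < ε := by
  have hC : ∀ x θ, 0 < normConst ν f x θ :=
    normConst_pos (ne_zero_of_instrLaw (h := h)) hf_pos hint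
  have hpos := ae_forall_instr_pos hh_pos hY_meas hY_law
  have hφm : Measurable fun q : 𝒴 × 𝒳 => phi ν f h θs q.1 q.2 :=
    measurable_phi hf_meas hf_smooth hint hh_meas
  have hφ0 : ∀ x, Integrable (fun y => phi ν f h θs y x) (instrLaw ν h) ∧
      ∫ y, phi ν f h θs y x ∂instrLaw ν h = 0 := phi_integrable_integral hh_meas hh_pos hC hint
  have hX_meas : ∀ i, Measurable fun ω => (Z i ω).2 := fun i => measurable_snd.comp (hZ_meas i)
  have hX_law : ∀ i, P.map (fun ω => (Z i ω).2) = G.snd := fun i => by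
    rw [Measure.snd, ← hZ_law i, Measure.map_map measurable_snd (hZ_meas i)]
    rfl
  have hX_indep : iIndepFun (fun i ω => (Z i ω).2) P :=
    hZ_indep.comp (fun _ => Prod.snd) fun _ => measurable_snd
  have hXY_indep : IndepFun (fun ω i => (Z i ω).2) (fun ω k => Y k ω) P :=
    hZY_indep.comp (φ := fun (z : ℕ → 𝒴 × 𝒳) i => (z i).2) (by fun_prop) measurable_id
  set A : ℕ → Ω → 𝒳 → Par p := fun m ω x =>
    (m : ℝ)⁻¹ • ∑ k ∈ Finset.range m, phi ν f h θs (Y k ω) x with hA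
  set R : ℕ × ℕ → Ω → Par p := fun a ω => (a.1 : ℝ)⁻¹ • ∑ i ∈ Finset.range a.1,
    (normConst ν f (Z i ω).2 θs / mcConst f h (fun k => Y k ω) a.2 (Z i ω).2 θs) •
      A a.2 ω (Z i ω).2 with hR
  set M : ℕ × ℕ → Ω → Par p := fun a ω =>
    (a.1 : ℝ)⁻¹ • ∑ i ∈ Finset.range a.1, A a.2 ω (Z i ω).2 with hM
  have hε3 : 0 < ε / 3 := by positivity
  have hfst : Tendsto (Prod.fst : ℕ × ℕ → ℕ) (atTop ×ˢ atTop) atTop := tendsto_fst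
  have hsnd : Tendsto (Prod.snd : ℕ × ℕ → ℕ) (atTop ×ˢ atTop) atTop := tendsto_snd
  -- Linearization: the remainder is an arbitrarily small multiple of `‖θhat - θs‖`, which is
  -- `O_p(1)` after scaling.
  have part1 : WithHighProb P (atTop ×ˢ atTop) fun (a : ℕ × ℕ) ω => √(min a.1 a.2 : ℕ) *
      ‖Matrix.toEuclideanLin (matD ν f G θs) (θhat a.1 a.2 ω - θs) +
        ((a.1 : ℝ)⁻¹ • ∑ i ∈ Finset.range a.1, score ν f θs (Z i ω) - R a ω)‖ < ε / 3 := by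
    refine hroot.withHighProb_lt (fun η hη => ?_) hε3
    have hη3 : 0 < η / 3 := by positivity
    obtain ⟨r, hr, hrδ, hDr⟩ := exists_frob_sub_le hD hη3 hδ
    have hball := Metric.closedBall_subset_closedBall hrδ (x := θs)
    refine ((((withHighProb_log_mcConst hf_pos hf_smooth hC hint hpos hδ ha hb hc hα hK
      hη3).comp hsnd).and ((hlik.withHighProb (ENNReal.ofReal_pos.2 hη3)).comp hfst)).and
      (((withHighProb_estimator_close tendsto_min_atTop hroot hr).and hmax).and
        (withHighProb_of_ae hpos))).mono ?_
    filter_upwards [hsnd.eventually (eventually_gt_atTop 0)] with a hm ω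
    rintro ⟨⟨e1, e2⟩, ⟨e3, e4⟩, e5⟩
    have key := norm_expansion_le hf_pos hf_smooth hC hint e5 hm
      (fun x θ hθ => e1 x θ (hball hθ))
      (fun θ hθ => (forall_mem_lt_of_iSup_ofReal_lt e2 θ (hball hθ)).le) hDr e3 e4
    have h3 : 3 * (η / 3) = η := by ring
    rw [h3] at key
    rw [abs_of_nonneg (by positivity), mul_left_comm]
    exact mul_le_mul_of_nonneg_left key (Real.sqrt_nonneg _)
  -- Replacing `C / C_m` by 1 costs at most `η` times the mean of norms, which is `O_p(1)` after
  -- scaling by `√m ≥ √min(n, m)`.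
  have part2 : WithHighProb P (atTop ×ˢ atTop) fun (a : ℕ × ℕ) ω => √(min a.1 a.2 : ℕ) *
      ‖R a ω - M a ω‖ < ε / 3 := by
    refine (boundedInProb_mean_norm hX_meas hX_law hY_meas hY_law hY_indep hXY_indep hφm hφL hφ0
      (atTop ×ˢ atTop)).withHighProb_lt (fun η hη => ?_) hε3
    refine ((withHighProb_ratio ha hα (fun x => (hK x θs (Metric.mem_closedBall_self hδ.le)).1)
      hη).comp hsnd).mono (Eventually.of_forall fun a ω e => ?_)
    rw [abs_of_nonneg (by positivity), mul_left_comm]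
    have hmin : √((min a.1 a.2 : ℕ) : ℝ) ≤ √(a.2 : ℝ) :=
      Real.sqrt_le_sqrt (by exact_mod_cast min_le_right _ _)
    refine mul_le_mul hmin ?_ (norm_nonneg _) (Real.sqrt_nonneg _)
    have hRM : R a ω - M a ω = (a.1 : ℝ)⁻¹ • ∑ i ∈ Finset.range a.1,
        (normConst ν f (Z i ω).2 θs / mcConst f h (fun k => Y k ω) a.2 (Z i ω).2 θs - 1) •
          A a.2 ω (Z i ω).2 := by
      simp only [hR, hM, sub_smul, one_smul, Finset.sum_sub_distrib, smul_sub]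
    rw [hRM, norm_smul, norm_inv, Real.norm_natCast, mul_left_comm, Finset.mul_sum]
    refine mul_le_mul_of_nonneg_left (norm_sum_le_of_le _ fun i _ => ?_) (by positivity)
    rw [norm_smul]
    exact mul_le_mul_of_nonneg_right (e _) (norm_nonneg _)
  have part3 := withHighProb_double_mean hX_meas hX_law hX_indep hY_meas hY_law hY_indep hXY_indep
    hφm hφL hφ0 hε3
  refine ((part1.and part2).and part3).mono (Eventually.of_forall fun a ω => ?_)
  rintro ⟨⟨e1, e2⟩, e3⟩
  change √(min a.1 a.2 : ℕ) * ‖M a ω -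
    (a.2 : ℝ)⁻¹ • ∑ k ∈ Finset.range a.2, phiBar ν f h G θs (Y k ω)‖ < ε / 3 at e3
  set T := (a.2 : ℝ)⁻¹ • ∑ k ∈ Finset.range a.2, phiBar ν f h G θs (Y k ω)
  set S := (a.1 : ℝ)⁻¹ • ∑ i ∈ Finset.range a.1, score ν f θs (Z i ω)
  set d := Matrix.toEuclideanLin (matD ν f G θs) (θhat a.1 a.2 ω - θs)
  have hsplit : d - (T - S) = (d + (S - R a ω)) + (R a ω - M a ω) + (M a ω - T) := by abel
  have hnorm : ‖d - (T - S)‖ ≤ ‖d + (S - R a ω)‖ + ‖R a ω - M a ω‖ + ‖M a ω - T‖ := by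
    rw [hsplit]
    exact norm_add₃_le
  have := mul_le_mul_of_nonneg_left hnorm (Real.sqrt_nonneg ((min a.1 a.2 : ℕ) : ℝ))
  linarith

end Estimator

end MCML

end

/-! ### Assembly: limit theorem, linearization and Slutsky -/

theorem theorem2
    {𝒴 𝒳 Ω : Type*} [MeasurableSpace 𝒴] [MeasurableSpace 𝒳] [MeasurableSpace Ω] {p : ℕ}
    -- the reference measure `dy`, the unnormalized densities and the instrumental density
    (ν : Measure 𝒴) [SigmaFinite ν]
    (f : 𝒴 → 𝒳 → MCML.Par p → ℝ)
    (hf_meas : ∀ θ, Measurable fun z : 𝒴 × 𝒳 => f z.1 z.2 θ)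
    (hf_pos : ∀ y x θ, 0 < f y x θ)
    (h : 𝒴 → ℝ) (hh_meas : Measurable h) (hh_pos : ∀ᵐ y ∂ν, 0 < h y)
    [IsProbabilityMeasure (MCML.instrLaw ν h)]
    -- the law of the pairs `(Y, X)`
    (G : Measure (𝒴 × 𝒳)) [IsProbabilityMeasure G]
    -- the i.i.d. data, and an independent i.i.d. Monte Carlo sample
    (P : Measure Ω) [IsProbabilityMeasure P]
    (Z : ℕ → Ω → 𝒴 × 𝒳) (hZ_meas : ∀ i, Measurable (Z i)) (hZ_law : ∀ i, P.map (Z i) = G)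
    (hZ_indep : iIndepFun Z P)
    (Y : ℕ → Ω → 𝒴) (hY_meas : ∀ k, Measurable (Y k))
    (hY_law : ∀ k, P.map (Y k) = MCML.instrLaw ν h)
    (hY_indep : iIndepFun Y P)
    (hZY_indep : IndepFun (fun ω i => Z i ω) (fun ω k => Y k ω) P)
    -- the Kullback-Leibler projection and a neighbourhood of it
    (θs : MCML.Par p) (δ : ℝ) (hδ : 0 < δ)
    (hKL_int : ∀ θ ∈ Metric.closedBall θs δ,
      Integrable (fun z : 𝒴 × 𝒳 => MCML.logDens ν f z.1 z.2 θ) G)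
    (hKL_max : ∀ θ, Integrable (fun z : 𝒴 × 𝒳 => MCML.logDens ν f z.1 z.2 θ) G →
      ∫ z, MCML.logDens ν f z.1 z.2 θ ∂G ≤ ∫ z, MCML.logDens ν f z.1 z.2 θs ∂G)
    -- the estimator: a maximizer of the Monte Carlo log-likelihood
    (θhat : ℕ → ℕ → Ω → MCML.Par p) (hθhat_meas : ∀ n m, AEMeasurable (θhat n m) P)
    (hθhat_max : Tendsto
      (fun a : ℕ × ℕ => P {ω | ¬ IsMaxOn
        (MCML.mcLogLik f h (fun i => Z i ω) (fun k => Y k ω) a.1 a.2) Set.univ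
        (θhat a.1 a.2 ω)})
      (atTop ×ˢ atTop) (𝓝 0))
    -- 1. smoothness, differentiation under the integral sign
    (h1_smooth : ∀ y x, ContDiff ℝ 2 (f y x))
    (h1_int : ∀ x, MCML.DiffUnderIntegral ν f x)
    -- 2. square root consistency
    (h2 : MCML.BoundedInProb P (atTop ×ˢ atTop) fun (a : ℕ × ℕ) ω =>
      Real.sqrt (min a.1 a.2 : ℕ) * ‖θhat a.1 a.2 ω - θs‖)
    -- 3. existence of `V`, `D`, `E |φ(Y | X)|²`; `D` is negative definite
    (h3_V : MemLp (MCML.score ν f θs) 2 G)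
    (h3_D : ∀ θ ∈ Metric.closedBall θs δ, ∀ r s,
      Integrable (fun z : 𝒴 × 𝒳 => MCML.hess (MCML.logDens ν f z.1 z.2) θ r s) G)
    (h3_W : Integrable (fun q : 𝒴 × 𝒳 => ‖MCML.phi ν f h θs q.1 q.2‖ ^ 2)
      ((MCML.instrLaw ν h).prod G.snd))
    (h3_neg : (-MCML.matD ν f G θs).PosDef)
    -- 4. continuity of `D(θ)` at `θs`
    (h4 : ContinuousAt (MCML.matD ν f G) θs)
    -- 5. uniform convergence of the Hessians of the log-likelihood
    (h5 : MCML.TendstoZeroInProb P atTop fun n ω => ⨆ θ ∈ Metric.closedBall θs δ,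
      ENNReal.ofReal (MCML.frob
        (MCML.hess (MCML.avgLogLik ν f (fun i => Z i ω) n) θ - MCML.matD ν f G θ)))
    -- 6. uniform convergence of the Monte Carlo approximations and of their derivatives
    (h6a : MCML.TendstoZeroInProb P atTop fun m ω => ⨆ x : 𝒳,
      ENNReal.ofReal |MCML.mcConst f h (fun k => Y k ω) m x θs - MCML.normConst ν f x θs|)
    (h6b : MCML.TendstoZeroInProb P atTop fun m ω => ⨆ x : 𝒳,
      ENNReal.ofReal ‖gradient (MCML.mcConst f h (fun k => Y k ω) m x) θs -
        gradient (MCML.normConst ν f x) θs‖)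
    (h6c : MCML.TendstoZeroInProb P atTop fun m ω =>
      ⨆ θ ∈ Metric.closedBall θs δ, ⨆ x : 𝒳,
      ENNReal.ofReal (MCML.frob
        (MCML.hess (MCML.mcConst f h (fun k => Y k ω) m x) θ -
          MCML.hess (MCML.normConst ν f x) θ)))
    -- 7. bounds on `C` and on its derivatives
    (h7 : ∃ α K : ℝ, 0 < α ∧ 0 < K ∧ ∀ x, ∀ θ ∈ Metric.closedBall θs δ,
      α ≤ MCML.normConst ν f x θ ∧ MCML.normConst ν f x θ ≤ K ∧
      ‖gradient (MCML.normConst ν f x) θ‖ ≤ K ∧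
      MCML.frob (MCML.hess (MCML.normConst ν f x) θ) ≤ K) :
    -- `W` is finite
    ((∀ᵐ y ∂MCML.instrLaw ν h, Integrable (MCML.phi ν f h θs y) G.snd) ∧
      MemLp (MCML.phiBar ν f h G θs) 2 (MCML.instrLaw ν h)) ∧
    -- asymptotic normality
    ((MCML.matV ν f G θs).PosDef → (MCML.matW ν f h G θs).PosDef →
      TendstoInDistribution
        (fun (a : ℕ × ℕ) ω => Matrix.toEuclideanLin
          (MCML.invSqrt ((a.1 : ℝ)⁻¹ • MCML.matV ν f G θs +
            (a.2 : ℝ)⁻¹ • MCML.matW ν f h G θs) * MCML.matD ν f G θs)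
          (θhat a.1 a.2 ω - θs))
        (atTop ×ˢ atTop) id (fun _ => P) (stdGaussian (MCML.Par p))) := by
  have hC : ∀ x θ, 0 < MCML.normConst ν f x θ :=
    MCML.normConst_pos (MCML.ne_zero_of_instrLaw (h := h)) hf_pos h1_int
  have hφm : Measurable fun q : 𝒴 × 𝒳 => MCML.phi ν f h θs q.1 q.2 :=
    MCML.measurable_phi hf_meas h1_smooth h1_int hh_meas
  have hφ0 : ∀ x, Integrable (fun y => MCML.phi ν f h θs y x) (MCML.instrLaw ν h) ∧
      ∫ y, MCML.phi ν f h θs y x ∂MCML.instrLaw ν h = 0 :=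
    MCML.phi_integrable_integral hh_meas hh_pos hC h1_int
  have hφL : MemLp (fun q : 𝒴 × 𝒳 => MCML.phi ν f h θs q.1 q.2) 2
      ((MCML.instrLaw ν h).prod G.snd) :=
    (memLp_two_iff_integrable_sq_norm hφm.aestronglyMeasurable).2 h3_W
  have hbarm : Measurable (MCML.phiBar ν f h G θs) := MCML.measurable_integral_right hφm
  have hbarL : MemLp (MCML.phiBar ν f h G θs) 2 (MCML.instrLaw ν h) :=
    MCML.memLp_integral_right hφm hφL
  have hbar0 : ∫ y, MCML.phiBar ν f h G θs y ∂MCML.instrLaw ν h = 0 :=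
    MCML.integral_integral_right_eq_zero hφL fun x => (hφ0 x).2
  refine ⟨⟨(hφL.integrable (by norm_num)).prod_right_ae, hbarL⟩, fun hV hW => ?_⟩
  have hscm : Measurable (MCML.score ν f θs) :=
    MCML.measurable_score hf_meas (MCML.differentiable_logDens hf_pos h1_smooth hC h1_int)
  have hsc0 : ∫ z, MCML.score ν f θs z ∂G = 0 :=
    MCML.integral_score_eq_zero hf_meas hf_pos h1_smooth hC h1_int hZ_meas hZ_law hZ_indep hδ
      hKL_int hKL_max (h3_V.integrable (by norm_num)) h4 h5
  have hclt := MCML.tendstoInDistribution_two_sample hZ_meas hZ_law hZ_indep hY_meas hY_law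
    hY_indep hZY_indep hbarm hbarL hbar0 hscm h3_V hsc0 hV hW
  obtain ⟨α, K, hα, -, hK⟩ := h7
  obtain ⟨c, hc, hB⟩ := MCML.exists_norm_invSqrt_le hV hW
  -- Slutsky: the standardized estimator has to differ by `o_p(1)` from the standardized difference
  -- of means.
  refine tendstoInDistribution_of_tendstoInMeasure_sub _ _ hclt ?_ fun a => ?_
  · rw [tendstoInMeasure_iff_norm]
    intro ε hε
    -- The tolerance `ε / c` offsets the norm bound `c * √min(n, m)` of the standardizing matrix.
    have hlin := MCML.withHighProb_asymptotic_linear hf_meas hf_pos hh_meas hh_pos h1_smooth h1_int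
      hZ_meas hZ_law hZ_indep hY_meas hY_law hY_indep hZY_indep hδ hθhat_max h2 hφL h4 h5 h6a h6b
      h6c hα hK (div_pos hε hc)
    refine Tendsto.congr (fun a => ?_) (hlin.mono (F := fun a ω => ‖Matrix.toEuclideanLin
        (MCML.invSqrt ((a.1 : ℝ)⁻¹ • MCML.matV ν f G θs + (a.2 : ℝ)⁻¹ • MCML.matW ν f h G θs) *
          MCML.matD ν f G θs) (θhat a.1 a.2 ω - θs) -
        Matrix.toEuclideanLin
        (MCML.invSqrt ((a.1 : ℝ)⁻¹ • MCML.matV ν f G θs + (a.2 : ℝ)⁻¹ • MCML.matW ν f h G θs))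
        ((a.2 : ℝ)⁻¹ • ∑ k ∈ Finset.range a.2, MCML.phiBar ν f h G θs (Y k ω) -
          (a.1 : ℝ)⁻¹ • ∑ i ∈ Finset.range a.1, MCML.score ν f θs (Z i ω))‖ < ε) ?_)
    · simp only [not_lt, Pi.sub_apply, Pi.zero_apply, sub_zero]
      rfl
    · filter_upwards [(eventually_gt_atTop 0).prod_mk (eventually_gt_atTop 0)] with a ha ω hω
      rw [Matrix.toLpLin_mul_same, LinearMap.comp_apply, ← map_sub]
      refine (hB a.1 a.2 ha.1 ha.2 _).trans_lt ?_
      rw [lt_div_iff₀' hc, ← mul_assoc] at hω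
      exact hω
  · exact (LinearMap.continuous_of_finiteDimensional _).measurable.comp_aemeasurable
      ((hθhat_meas a.1 a.2).sub_const θs)
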